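/- **Setting.** All vector spaces, tensor products and Hopf algebras are over $\mathbb C$; Sweedler notation $\Delta(c)=c_{(1)}\otimes c_{(2)}$ is used and repeated indices are summed. An affine algebraic group $G$ is a group that is an affine algebraic set (zero locus of polynomials in some $\mathbb C^n$) whose multiplication and inversion are polynomial maps. $\mathcal P(G)$ is its algebra of polynomial functions, a commutative Hopf algebra with $\Delta(f)(x,y)=f(xy)$ (under $\mathcal P(G)\otimes\mathcal P(G)=\mathcal P(G\times G)$), $\varepsilon(f)=f(e)$, $S(f)(x)=f(x^{-1})$. The Lie algebra $\mathfrak g$ of $G$ is the finite dimensional space of linear maps $X:\mathcal P(G)\to\mathbb C$ with $X(fg)=f(e)X(g)+X(f)g(e)$, with bracket $[X,Y](f)=X(f_{(1)})Y(f_{(2)})-Y(f_{(1)})X(f_{(2)})$. $U(\mathfrak g)$ is the universal enveloping algebra with its usual Hopf algebra structure (elements of $\mathfrak g$ primitive). A matched pair $(G_1,G_2)$ of affine algebraic groups consists of a left action $\rhd:G_2\times G_1\to G_1$ of $G_2$ on the set $G_1$ and a right action $\lhd:G_2\times G_1\to G_2$ of $G_1$ on the set $G_2$, both maps of affine algebraic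 sets, such that for all $\varphi,\varphi_i\in G_1$, $\psi,\psi_i\in G_2$ $$\psi\rhd(\varphi_1\varphi_2)=(\psi\rhd\varphi_1)\big((\psi\lhd\varphi_1)\rhd\varphi_2\big),\quad \psi\rhd e=e,\quad (\psi_1\psi_2)\lhd\varphi=\big(\psi_1\lhd(\psi_2\rhd\varphi)\big)(\psi_2\lhd\varphi),\quad e\lhd\varphi=e.$$ *Action.* For $f\in\mathcal P(G_2)$ write $f(\psi\lhd\varphi)=f^{\langle0\rangle}(\psi)f^{\langle1\rangle}(\varphi)$ with $f^{\langle0\rangle}\otimes f^{\langle1\rangle}\in\mathcal P(G_2)\otimes\mathcal P(G_1)$. Then $X\rhd f:=f^{\langle0\rangle}X(f^{\langle1\rangle})$ is an action of $\mathfrak g_1$ on $\mathcal P(G_2)$; it extends uniquely to a left action of the algebra $U(\mathfrak g_1)$. *Coaction.* $G_2$ acts on $\mathfrak g_1$ by $(\psi\rhd X)(f)=X(\varphi\mapsto f(\psi\rhd\varphi))$. For a basis $X_1,\dots,X_n$ of $\mathfrak g_1$ define $f_i^j$ by $\psi\rhd X_i=\sum_j f_i^j(\psi)X_j$; these are in $\mathcal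 P(G_2)$, and $\blacktriangledown_{pol}:\mathfrak g_1\to\mathfrak g_1\otimes\mathcal P(G_2)$ is the linear map $X_i\mapsto\sum_jX_j\otimes f_i^j$. **Theorem.** Let $(G_1,G_2)$ be a matched pair of affine algebraic groups over $\mathbb C$, $\mathcal U=U(\mathfrak g_1)$, $\mathcal F=\mathcal P(G_2)$, and let $X_1,\dots,X_n$ be a basis of $\mathfrak g_1$. There is exactly one linear map $\blacktriangledown:\mathcal U\to\mathcal U\otimes\mathcal F$, $\blacktriangledown u=u_{\langle0\rangle}\otimes u_{\langle1\rangle}$, that extends $\blacktriangledown_{pol}$ and satisfies $\blacktriangledown(1)=1\otimes1$ and $\blacktriangledown(uv)=u_{(1)\langle0\rangle}v_{\langle0\rangle}\otimes u_{(1)\langle1\rangle}(u_{(2)}\rhd v_{\langle1\rangle})$ for all $u,v\in\mathcal U$. With the above action and with $\blacktriangledown$, $(\mathcal U,\mathcal F)$ is a matched pair of Hopf algebras, i.e. for all $u,v\in\mathcal U$, $f,g\in\mathcal F$: 1. $\rhd$ is a left action making $\mathcal F$ a left $\mathcal U$-module algebra: $u\rhd1=\varepsilon(u)1$, $u\rhd(fg)=(u_{(1)}\rhd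 f)(u_{(2)}\rhd g)$; 2. $\blacktriangledown$ is a (coassociative and counital) right coaction making $\mathcal U$ a right $\mathcal F$-comodule coalgebra: $u_{\langle0\rangle(1)}\otimes u_{\langle0\rangle(2)}\otimes u_{\langle1\rangle}=u_{(1)\langle0\rangle}\otimes u_{(2)\langle0\rangle}\otimes u_{(1)\langle1\rangle}u_{(2)\langle1\rangle}$ and $\varepsilon(u_{\langle0\rangle})u_{\langle1\rangle}=\varepsilon(u)1$; 3. $\varepsilon(u\rhd f)=\varepsilon(u)\varepsilon(f)$; 4. $\Delta(u\rhd f)=u_{(1)\langle0\rangle}\rhd f_{(1)}\otimes u_{(1)\langle1\rangle}(u_{(2)}\rhd f_{(2)})$; 5. $\blacktriangledown(1)=1\otimes1$; 6. $\blacktriangledown(uv)=u_{(1)\langle0\rangle}v_{\langle0\rangle}\otimes u_{(1)\langle1\rangle}(u_{(2)}\rhd v_{\langle1\rangle})$; 7. $u_{(2)\langle0\rangle}\otimes(u_{(1)}\rhd f)u_{(2)\langle1\rangle}=u_{(1)\langle0\rangle}\otimes u_{(1)\langle1\rangle}(u_{(2)}\rhd f)$. -/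

import Mathlib

open scoped TensorProduct Coalgebra

noncomputable section

namespace AlgGroup

/-! ### Affine algebraic sets over `ℂ` and their polynomial functions -/

/-- A realization of `X` as an affine algebraic set over `ℂ`: a bijection of `X` with the zero
locus of an ideal of polynomials in finitely many variables. -/
class AffineAlgebraicSet (X : Type*) where
  Coord : Type
  finite_coord : Finite Coord
  coord : X → Coord → ℂ
  coord_injective : Function.Injective coord
  locus : Ideal (MvPolynomial Coord ℂ)
  range_coord : Set.range coord = MvPolynomial.zeroLocus ℂ locus

/-- The algebra `𝒫(X)` of polynomial functions on `X`, generated by the coordinate functions. -/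
def polyFun (X : Type*) [AffineAlgebraicSet X] : Subalgebra ℂ (X → ℂ) :=
  Algebra.adjoin ℂ (Set.range fun (i : AffineAlgebraicSet.Coord X) (x : X) =>
    AffineAlgebraicSet.coord x i)

/-- `𝒫(X)` as a type. -/
def PolyFun (X : Type*) [AffineAlgebraicSet X] : Type _ := ↥(polyFun X)

instance (X : Type*) [AffineAlgebraicSet X] : CommRing (PolyFun X) :=
  inferInstanceAs (CommRing ↥(polyFun X))

instance (X : Type*) [AffineAlgebraicSet X] : Algebra ℂ (PolyFun X) :=
  inferInstanceAs (Algebra ℂ ↥(polyFun X))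

instance (X : Type*) [AffineAlgebraicSet X] : FunLike (PolyFun X) X ℂ where
  coe f := Subtype.val f
  coe_injective := Subtype.val_injective

/-- An element of `polyFun X` as an element of the type `PolyFun X`. -/
def PolyFun.mk {X : Type*} [AffineAlgebraicSet X] (f : X → ℂ) (hf : f ∈ polyFun X) : PolyFun X :=
  (⟨f, hf⟩ : ↥(polyFun X))

lemma PolyFun.mem {X : Type*} [AffineAlgebraicSet X] (f : PolyFun X) : ⇑f ∈ polyFun X :=
  Subtype.prop (p := fun g => g ∈ polyFun X) f

lemma PolyFun.ext {X : Type*} [AffineAlgebraicSet X] {f g : PolyFun X} (h : ∀ x, f x = g x) :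
    f = g := DFunLike.ext f g h

/-- A map of affine algebraic sets: polynomial functions pull back to polynomial functions. -/
def IsMorphism {X Y : Type*} [AffineAlgebraicSet X] [AffineAlgebraicSet Y] (φ : X → Y) : Prop :=
  ∀ f ∈ polyFun Y, f ∘ φ ∈ polyFun X

/-- The algebra map `𝒫(φ) : 𝒫(Y) → 𝒫(X)`, `f ↦ f ∘ φ`. -/
def pullback {X Y : Type*} [AffineAlgebraicSet X] [AffineAlgebraicSet Y] (φ : X → Y)
    (h : IsMorphism φ) : PolyFun Y →ₐ[ℂ] PolyFun X where
  toFun f := .mk (f ∘ φ) (h f f.mem)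
  map_one' := rfl
  map_mul' _ _ := rfl
  map_zero' := rfl
  map_add' _ _ := rfl
  commutes' _ := rfl

/-- Evaluation at a point. -/
def evalAt {X : Type*} [AffineAlgebraicSet X] (x : X) : PolyFun X →ₐ[ℂ] ℂ :=
  (Pi.evalAlgHom ℂ (fun _ : X => ℂ) x).comp (polyFun X).val

@[simp] lemma evalAt_apply {X : Type*} [AffineAlgebraicSet X] (x : X) (f : PolyFun X) :
    evalAt x f = f x := rfl

@[simp] lemma pullback_apply {X Y : Type*} [AffineAlgebraicSet X] [AffineAlgebraicSet Y]
    (φ : X → Y) (h : IsMorphism φ) (f : PolyFun Y) (x : X) : pullback φ h f x = f (φ x) := rfl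

section Product

variable {X Y Z : Type*} [AffineAlgebraicSet X] [AffineAlgebraicSet Y] [AffineAlgebraicSet Z]

lemma isMorphism_of_coord {φ : X → Y}
    (h : ∀ i : AffineAlgebraicSet.Coord Y,
      (fun x => AffineAlgebraicSet.coord (φ x) i) ∈ polyFun X) : IsMorphism φ := by
  intro f hf
  induction hf using Algebra.adjoin_induction with
  | mem f hf => obtain ⟨i, rfl⟩ := hf; exact h i
  | algebraMap r => exact (polyFun X).algebraMap_mem r
  | add f g _ _ hf hg => exact (polyFun X).add_mem hf hg
  | mul f g _ _ hf hg => exact (polyFun X).mul_mem hf hg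

/-- The product of two affine algebraic sets. -/
instance : AffineAlgebraicSet (X × Y) where
  Coord := AffineAlgebraicSet.Coord X ⊕ AffineAlgebraicSet.Coord Y
  finite_coord := by
    have := AffineAlgebraicSet.finite_coord (X := X)
    have := AffineAlgebraicSet.finite_coord (X := Y)
    infer_instance
  coord p := Sum.elim (AffineAlgebraicSet.coord p.1) (AffineAlgebraicSet.coord p.2)
  coord_injective := by
    rintro ⟨x, y⟩ ⟨x', y'⟩ h
    refine Prod.ext (AffineAlgebraicSet.coord_injective ?_)
      (AffineAlgebraicSet.coord_injective ?_)
    · funext i; exact congrFun h (Sum.inl i)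
    · funext i; exact congrFun h (Sum.inr i)
  locus := (AffineAlgebraicSet.locus (X := X)).map (MvPolynomial.rename Sum.inl) ⊔
    (AffineAlgebraicSet.locus (X := Y)).map (MvPolynomial.rename Sum.inr)
  range_coord := by
    ext v
    have key : v ∈ MvPolynomial.zeroLocus ℂ
        ((AffineAlgebraicSet.locus (X := X)).map (MvPolynomial.rename (R := ℂ)
            (Sum.inl : _ → AffineAlgebraicSet.Coord X ⊕ AffineAlgebraicSet.Coord Y)) ⊔
          (AffineAlgebraicSet.locus (X := Y)).map (MvPolynomial.rename (R := ℂ) Sum.inr)) ↔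
        (v ∘ Sum.inl) ∈ MvPolynomial.zeroLocus ℂ (AffineAlgebraicSet.locus (X := X)) ∧
        (v ∘ Sum.inr) ∈ MvPolynomial.zeroLocus ℂ (AffineAlgebraicSet.locus (X := Y)) := by
      have h1 : ∀ I : Ideal (MvPolynomial
          (AffineAlgebraicSet.Coord X ⊕ AffineAlgebraicSet.Coord Y) ℂ),
          v ∈ MvPolynomial.zeroLocus ℂ I ↔ I ≤ RingHom.ker (MvPolynomial.aeval (R := ℂ) v) :=
        fun I => Iff.rfl
      rw [h1, sup_le_iff, Ideal.map_le_iff_le_comap, Ideal.map_le_iff_le_comap]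
      refine and_congr ?_ ?_ <;>
      · refine forall₂_congr fun p _ => ?_
        rw [Ideal.mem_comap, RingHom.mem_ker, MvPolynomial.aeval_rename]
    rw [key, ← AffineAlgebraicSet.range_coord, ← AffineAlgebraicSet.range_coord]
    constructor
    · rintro ⟨p, rfl⟩
      exact ⟨⟨p.1, rfl⟩, ⟨p.2, rfl⟩⟩
    · rintro ⟨⟨x, hx⟩, ⟨y, hy⟩⟩
      refine ⟨(x, y), ?_⟩
      funext i
      rcases i with i | i
      · exact congrFun hx i
      · exact congrFun hy i

lemma isMorphism_fst : IsMorphism (Prod.fst : X × Y → X) :=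
  isMorphism_of_coord fun i => Algebra.subset_adjoin ⟨Sum.inl i, rfl⟩

lemma isMorphism_snd : IsMorphism (Prod.snd : X × Y → Y) :=
  isMorphism_of_coord fun i => Algebra.subset_adjoin ⟨Sum.inr i, rfl⟩

lemma isMorphism_prodMk {φ : Z → X} {χ : Z → Y} (hφ : IsMorphism φ) (hχ : IsMorphism χ) :
    IsMorphism fun z => (φ z, χ z) := by
  refine isMorphism_of_coord fun i => ?_
  rcases i with i | i
  · exact hφ _ (Algebra.subset_adjoin ⟨i, rfl⟩)
  · exact hχ _ (Algebra.subset_adjoin ⟨i, rfl⟩)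

lemma isMorphism_const (y : Y) : IsMorphism (fun _ : X => y) :=
  isMorphism_of_coord fun i => (polyFun X).algebraMap_mem (AffineAlgebraicSet.coord y i)

lemma isMorphism_id : IsMorphism (id : X → X) := fun _ hf => hf

lemma IsMorphism.comp {φ : Y → Z} {χ : X → Y} (hφ : IsMorphism φ) (hχ : IsMorphism χ) :
    IsMorphism (φ ∘ χ) := fun f hf => hχ _ (hφ f hf)

/-- An element of `𝒫(X) ⊗ V` is determined by its values at the points of `X`. -/
lemma tensor_ext {V : Type*} [AddCommGroup V] [Module ℂ V] {s t : PolyFun X ⊗[ℂ] V}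
    (h : ∀ x, (evalAt x).toLinearMap.rTensor V s = (evalAt x).toLinearMap.rTensor V t) :
    s = t := by
  classical
  let b := Module.Basis.ofVectorSpace ℂ V
  have nat : ∀ (x : X) (s : PolyFun X ⊗[ℂ] V) i,
      TensorProduct.equivFinsuppOfBasisRight b ((evalAt x).toLinearMap.rTensor V s) i =
        evalAt x (TensorProduct.equivFinsuppOfBasisRight b s i : PolyFun X) := by
    intro x s i
    induction s with
    | zero => simp only [map_zero, Finsupp.zero_apply]
    | tmul f v =>
      simp
    | add s t hs ht => simp only [map_add, Finsupp.add_apply, hs, ht]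
  apply (TensorProduct.equivFinsuppOfBasisRight b).injective
  refine Finsupp.ext fun i => PolyFun.ext fun x => ?_
  rw [← evalAt_apply, ← evalAt_apply, ← nat, ← nat, h]

/-- The value of an element of `𝒫(X) ⊗ 𝒫(Y)` at a pair of points. -/
def evalPair (x : X) (y : Y) : PolyFun X ⊗[ℂ] PolyFun Y →ₐ[ℂ] ℂ :=
  Algebra.TensorProduct.lift (evalAt x) (evalAt y) fun _ _ => Commute.all _ _

@[simp] lemma evalPair_tmul (x : X) (y : Y) (f : PolyFun X) (g : PolyFun Y) :
    evalPair x y (f ⊗ₜ g) = f x * g y := rfl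

lemma evalPair_ext {s t : PolyFun X ⊗[ℂ] PolyFun Y}
    (h : ∀ x y, evalPair x y s = evalPair x y t) : s = t := by
  refine tensor_ext fun x => ?_
  apply (TensorProduct.lid ℂ (PolyFun Y)).injective
  refine PolyFun.ext fun y => ?_
  have nat : ∀ s : PolyFun X ⊗[ℂ] PolyFun Y,
      evalAt y (TensorProduct.lid ℂ (PolyFun Y) ((evalAt x).toLinearMap.rTensor _ s)) =
        evalPair x y s := by
    intro s
    induction s with
    | zero => simp only [map_zero]
    | tmul f v => simp
    | add s t hs ht => simp only [map_add, hs, ht]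
  rw [← evalAt_apply, ← evalAt_apply, nat, nat, h]

/-- The value of an element of `𝒫(X) ⊗ 𝒫(Y) ⊗ 𝒫(Z)` at a triple of points. -/
def evalTriple (x : X) (y : Y) (z : Z) : PolyFun X ⊗[ℂ] (PolyFun Y ⊗[ℂ] PolyFun Z) →ₐ[ℂ] ℂ :=
  Algebra.TensorProduct.lift (evalAt x) (evalPair y z) fun _ _ => Commute.all _ _

lemma evalTriple_ext {s t : PolyFun X ⊗[ℂ] (PolyFun Y ⊗[ℂ] PolyFun Z)}
    (h : ∀ x y z, evalTriple x y z s = evalTriple x y z t) : s = t := by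
  refine tensor_ext fun x => ?_
  apply (TensorProduct.lid ℂ _).injective
  refine evalPair_ext fun y z => ?_
  have key : ∀ t : PolyFun X ⊗[ℂ] (PolyFun Y ⊗[ℂ] PolyFun Z),
      evalPair y z (TensorProduct.lid ℂ _ ((evalAt x).toLinearMap.rTensor _ t)) =
      evalTriple x y z t := by
    intro t
    induction t with
    | zero => simp only [map_zero]
    | tmul f v =>
      rw [LinearMap.rTensor_tmul, TensorProduct.lid_tmul, map_smul]
      rfl
    | add s t hs ht => simp only [map_add, hs, ht]
  rw [key, key, h]

variable (X Y) in
/-- The map `𝒫(X) ⊗ 𝒫(Y) → 𝒫(X × Y)`, `(f ⊗ g)(x, y) = f x * g y`. -/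
def tensorToProd : PolyFun X ⊗[ℂ] PolyFun Y →ₐ[ℂ] PolyFun (X × Y) :=
  Algebra.TensorProduct.lift (pullback Prod.fst isMorphism_fst)
    (pullback Prod.snd isMorphism_snd) fun _ _ => Commute.all _ _

lemma tensorToProd_apply (t : PolyFun X ⊗[ℂ] PolyFun Y) (x : X) (y : Y) :
    tensorToProd X Y t (x, y) = evalPair x y t := by
  have : (evalAt (x, y)).comp (tensorToProd X Y) = evalPair x y :=
    Algebra.TensorProduct.ext' fun _ _ => rfl
  exact DFunLike.congr_fun this t

lemma tensorToProd_bijective : Function.Bijective (tensorToProd X Y) := by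
  constructor
  · intro s t h
    refine evalPair_ext fun x y => ?_
    rw [← tensorToProd_apply, ← tensorToProd_apply, h]
  · intro f
    suffices (f : X × Y → ℂ) ∈ ((polyFun (X × Y)).val.comp (tensorToProd X Y)).range by
      obtain ⟨t, ht⟩ := this
      exact ⟨t, Subtype.ext ht⟩
    refine (Algebra.adjoin_le ?_ : polyFun (X × Y) ≤ _) f.mem
    rintro _ ⟨i | i, rfl⟩
    · let t : PolyFun X ⊗[ℂ] PolyFun Y := .mk _ (Algebra.subset_adjoin ⟨i, rfl⟩) ⊗ₜ 1
      refine ⟨t, ?_⟩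
      funext ⟨x, y⟩
      refine (tensorToProd_apply t x y).trans ?_
      exact mul_one (AffineAlgebraicSet.coord x i)
    · let t : PolyFun X ⊗[ℂ] PolyFun Y := 1 ⊗ₜ .mk _ (Algebra.subset_adjoin ⟨i, rfl⟩)
      refine ⟨t, ?_⟩
      funext ⟨x, y⟩
      refine (tensorToProd_apply t x y).trans ?_
      exact one_mul (AffineAlgebraicSet.coord y i)

variable (X Y) in
/-- The identification `𝒫(X) ⊗ 𝒫(Y) = 𝒫(X × Y)`. -/
def tensorEquivProd : PolyFun X ⊗[ℂ] PolyFun Y ≃ₐ[ℂ] PolyFun (X × Y) :=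
  AlgEquiv.ofBijective (tensorToProd X Y) tensorToProd_bijective

/-- For a map `φ : X × Y → Z` of affine algebraic sets, the map `𝒫(Z) → 𝒫(X) ⊗ 𝒫(Y)`. -/
def copullback (φ : X × Y → Z) (h : IsMorphism φ) : PolyFun Z →ₐ[ℂ] PolyFun X ⊗[ℂ] PolyFun Y :=
  ((tensorEquivProd X Y).symm : PolyFun (X × Y) →ₐ[ℂ] PolyFun X ⊗[ℂ] PolyFun Y).comp
    (pullback φ h)

lemma evalPair_copullback (φ : X × Y → Z) (h : IsMorphism φ) (x : X) (y : Y) (f : PolyFun Z) :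
    evalPair x y (copullback φ h f) = f (φ (x, y)) := by
  rw [← tensorToProd_apply]
  have : tensorToProd X Y (copullback φ h f) = pullback φ h f :=
    (tensorEquivProd X Y).apply_symm_apply _
  rw [this]
  rfl

end Product

/-! ### Affine algebraic groups -/

/-- An affine algebraic group: multiplication and inversion are maps of affine algebraic sets. -/
class AffineAlgebraicGroup (G : Type*) [Group G] [AffineAlgebraicSet G] : Prop where
  isMorphism_mul : IsMorphism fun p : G × G => p.1 * p.2
  isMorphism_inv : IsMorphism fun x : G => x⁻¹

section HopfPoly

variable {G : Type*} [Group G] [AffineAlgebraicSet G] [AffineAlgebraicGroup G]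

variable (G) in
/-- The comultiplication of `𝒫(G)`: `Δ(f)(x, y) = f (x * y)`. -/
def polyComul : PolyFun G →ₐ[ℂ] PolyFun G ⊗[ℂ] PolyFun G :=
  copullback (fun p : G × G => p.1 * p.2) AffineAlgebraicGroup.isMorphism_mul

lemma evalPair_polyComul (x y : G) : (evalPair x y).comp (polyComul G) = evalAt (x * y) := by
  ext f
  exact evalPair_copullback _ _ x y f

lemma evalTriple_left (x y z : G) :
    (evalTriple x y z).comp
      ((Algebra.TensorProduct.assoc ℂ ℂ ℂ (PolyFun G) (PolyFun G) (PolyFun G)).toAlgHom.comp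
        (Algebra.TensorProduct.map (polyComul G) (.id ℂ (PolyFun G)))) = evalPair (x * y) z := by
  refine Algebra.TensorProduct.ext' fun f g => ?_
  have h0 : ∀ t : PolyFun G ⊗[ℂ] PolyFun G, evalTriple x y z
      (Algebra.TensorProduct.assoc ℂ ℂ ℂ (PolyFun G) (PolyFun G) (PolyFun G) (t ⊗ₜ g)) =
        evalPair x y t * g z := by
    intro t
    induction t with
    | zero => simp only [TensorProduct.zero_tmul, map_zero, zero_mul]
    | tmul a b => exact (mul_assoc _ _ _).symm
    | add s t hs ht => simp only [TensorProduct.add_tmul, map_add, hs, ht, add_mul]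
  refine (h0 (polyComul G f)).trans ?_
  rw [evalPair_tmul, ← evalAt_apply (x * y), ← evalPair_polyComul, AlgHom.comp_apply]

lemma evalTriple_right (x y z : G) :
    (evalTriple x y z).comp (Algebra.TensorProduct.map (.id ℂ (PolyFun G)) (polyComul G)) =
      evalPair x (y * z) := by
  refine Algebra.TensorProduct.ext' fun f g => ?_
  rw [evalPair_tmul, ← evalAt_apply (y * z), ← evalPair_polyComul]
  rfl

instance : Bialgebra ℂ (PolyFun G) :=
  Bialgebra.ofAlgHom (polyComul G) (evalAt 1)
    (by
      refine AlgHom.ext fun f => evalTriple_ext fun x y z => ?_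
      have e1 := DFunLike.congr_fun (evalTriple_left x y z) (polyComul G f)
      have e2 := DFunLike.congr_fun (evalTriple_right x y z) (polyComul G f)
      have e3 := DFunLike.congr_fun (evalPair_polyComul (x * y) z) f
      have e4 := DFunLike.congr_fun (evalPair_polyComul x (y * z)) f
      refine e1.trans (e3.trans (Eq.trans ?_ (e2.trans e4).symm))
      rw [mul_assoc])
    (by
      refine AlgHom.ext fun f => ?_
      apply (TensorProduct.lid ℂ _).injective
      refine PolyFun.ext fun x => ?_
      have key : ∀ t : PolyFun G ⊗[ℂ] PolyFun G,
          evalAt x (TensorProduct.lid ℂ _ (Algebra.TensorProduct.map (evalAt 1) (.id ℂ _) t)) =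
          evalPair 1 x t := by
        intro t
        induction t with
        | zero => simp only [map_zero]
        | tmul f v => simp
        | add s t hs ht => simp only [map_add, hs, ht]
      refine (key _).trans ?_
      refine (DFunLike.congr_fun (evalPair_polyComul 1 x) f).trans ?_
      simp)
    (by
      refine AlgHom.ext fun f => ?_
      apply (TensorProduct.rid ℂ _).injective
      refine PolyFun.ext fun x => ?_
      have key : ∀ t : PolyFun G ⊗[ℂ] PolyFun G,
          evalAt x (TensorProduct.rid ℂ _ (Algebra.TensorProduct.map (.id ℂ _) (evalAt 1) t)) =
          evalPair x 1 t := by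
        intro t
        induction t with
        | zero => simp only [map_zero]
        | tmul f v => simp [mul_comm]
        | add s t hs ht => simp only [map_add, hs, ht]
      refine (key _).trans ?_
      refine (DFunLike.congr_fun (evalPair_polyComul x 1) f).trans ?_
      simp)

/-- `𝒫(G)` is a Hopf algebra with `Δ(f)(x, y) = f (x * y)`, `ε(f) = f 1`, `S(f)(x) = f x⁻¹`. -/
instance : HopfAlgebra ℂ (PolyFun G) :=
  HopfAlgebra.ofAlgHom (pullback (fun x : G => x⁻¹) AffineAlgebraicGroup.isMorphism_inv)
    (by
      refine AlgHom.ext fun f => PolyFun.ext fun x => ?_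
      have key : (evalAt x).comp (Algebra.TensorProduct.lift
          (pullback (fun x : G => x⁻¹) AffineAlgebraicGroup.isMorphism_inv) (.id ℂ (PolyFun G))
          fun _ => Commute.all _) = evalPair x⁻¹ x := by
        refine Algebra.TensorProduct.ext' fun f g => ?_
        rfl
      refine (DFunLike.congr_fun key (polyComul G f)).trans ?_
      refine (DFunLike.congr_fun (evalPair_polyComul x⁻¹ x) f).trans ?_
      rw [inv_mul_cancel]; rfl)
    (by
      refine AlgHom.ext fun f => PolyFun.ext fun x => ?_
      have key : (evalAt x).comp (Algebra.TensorProduct.lift (.id ℂ (PolyFun G))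
          (pullback (fun x : G => x⁻¹) AffineAlgebraicGroup.isMorphism_inv)
          fun _ _ => Commute.all _ _) = evalPair x x⁻¹ := by
        refine Algebra.TensorProduct.ext' fun f g => ?_
        rfl
      refine (DFunLike.congr_fun key (polyComul G f)).trans ?_
      refine (DFunLike.congr_fun (evalPair_polyComul x x⁻¹) f).trans ?_
      rw [mul_inv_cancel]; rfl)

lemma comul_eq_polyComul (f : PolyFun G) : CoalgebraStruct.comul (R := ℂ) f = polyComul G f := rfl

lemma counit_eq (f : PolyFun G) : CoalgebraStruct.counit (R := ℂ) f = f 1 := rfl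

end HopfPoly

/-! ### The Hopf algebra `U(L)` -/

attribute [local instance 100] LieRing.ofAssociativeRing

section Enveloping

variable {L : Type*} [LieRing L] [LieAlgebra ℂ L]

local notation "U(" L ")" => UniversalEnvelopingAlgebra ℂ L

lemma env_algHom_ext {A : Type*} [Ring A] [Algebra ℂ A] {f g : U(L) →ₐ[ℂ] A}
    (h : ∀ X, f (UniversalEnvelopingAlgebra.ι ℂ X) = g (UniversalEnvelopingAlgebra.ι ℂ X)) :
    f = g :=
  UniversalEnvelopingAlgebra.hom_ext ℂ (LieHom.ext h)

lemma enveloping_induction {P : U(L) → Prop} (hι : ∀ X, P (UniversalEnvelopingAlgebra.ι ℂ X))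
    (halg : ∀ r : ℂ, P (algebraMap ℂ _ r)) (hadd : ∀ u v, P u → P v → P (u + v))
    (hmul : ∀ u v, P u → P v → P (u * v)) (u : U(L)) : P u := by
  let S : Subalgebra ℂ U(L) :=
    { carrier := {u | P u}
      mul_mem' := fun {u v} => hmul u v
      add_mem' := fun {u v} => hadd u v
      algebraMap_mem' := halg }
  let j : L →ₗ⁅ℂ⁆ S :=
    { toFun := fun X => ⟨UniversalEnvelopingAlgebra.ι ℂ X, hι X⟩
      map_add' := fun X Y => Subtype.ext (map_add _ X Y)
      map_smul' := fun c X => Subtype.ext (map_smul _ c X)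
      map_lie' := fun {X Y} => Subtype.ext (LieHom.map_lie _ X Y) }
  have h : S.val.comp (UniversalEnvelopingAlgebra.lift ℂ j) = AlgHom.id ℂ _ := by
    refine env_algHom_ext fun X => ?_
    exact congrArg Subtype.val (UniversalEnvelopingAlgebra.lift_ι_apply ℂ j X)
  have := (UniversalEnvelopingAlgebra.lift ℂ j u).2
  have e : ((UniversalEnvelopingAlgebra.lift ℂ j u : S) : U(L)) = u := DFunLike.congr_fun h u
  rw [← e]
  exact this

variable (L) in
/-- The comultiplication of `U(L)`, with `Δ(X) = X ⊗ 1 + 1 ⊗ X` for `X ∈ L`. -/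
def envComul : U(L) →ₐ[ℂ] U(L) ⊗[ℂ] U(L) :=
  UniversalEnvelopingAlgebra.lift ℂ
    { toFun := fun X =>
        UniversalEnvelopingAlgebra.ι ℂ X ⊗ₜ 1 + 1 ⊗ₜ UniversalEnvelopingAlgebra.ι ℂ X
      map_add' := fun X Y => by
        simp only [map_add, TensorProduct.add_tmul, TensorProduct.tmul_add]; abel
      map_smul' := fun c X => by
        simp only [map_smul, TensorProduct.smul_tmul', TensorProduct.tmul_smul, smul_add,
          RingHom.id_apply]
      map_lie' := fun {X Y} => by
        simp only [LieHom.map_lie, LieRing.of_associative_ring_bracket, mul_add, add_mul,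
          Algebra.TensorProduct.tmul_mul_tmul, one_mul, mul_one, TensorProduct.sub_tmul,
          TensorProduct.tmul_sub]
        abel }

lemma envComul_ι (X : L) : envComul L (UniversalEnvelopingAlgebra.ι ℂ X) =
    UniversalEnvelopingAlgebra.ι ℂ X ⊗ₜ 1 + 1 ⊗ₜ UniversalEnvelopingAlgebra.ι ℂ X :=
  UniversalEnvelopingAlgebra.lift_ι_apply ℂ _ X

variable (L) in
/-- The counit of `U(L)`, with `ε(X) = 0` for `X ∈ L`. -/
def envCounit : U(L) →ₐ[ℂ] ℂ := UniversalEnvelopingAlgebra.lift ℂ 0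

lemma envCounit_ι (X : L) : envCounit L (UniversalEnvelopingAlgebra.ι ℂ X) = 0 :=
  UniversalEnvelopingAlgebra.lift_ι_apply ℂ _ X

variable (L) in
/-- The antipode of `U(L)` as an algebra map to the opposite algebra, with `S(X) = -X` for
`X ∈ L`. -/
def envAntipodeOp : U(L) →ₐ[ℂ] U(L)ᵐᵒᵖ :=
  UniversalEnvelopingAlgebra.lift ℂ
    { toFun := fun X => MulOpposite.op (-UniversalEnvelopingAlgebra.ι ℂ X)
      map_add' := fun X Y => by simp only [map_add, neg_add, MulOpposite.op_add]
      map_smul' := fun c X => by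
        simp only [map_smul, ← smul_neg, MulOpposite.op_smul, RingHom.id_apply]
      map_lie' := fun {X Y} => by
        apply MulOpposite.unop_injective
        simp only [LieHom.map_lie, LieRing.of_associative_ring_bracket, MulOpposite.unop_op,
          MulOpposite.unop_sub, MulOpposite.unop_mul]
        noncomm_ring }

variable (L) in
/-- The antipode of `U(L)`. -/
def envAntipode : U(L) →ₗ[ℂ] U(L) :=
  (MulOpposite.opLinearEquiv ℂ).symm.toLinearMap ∘ₗ (envAntipodeOp L).toLinearMap

lemma envAntipode_ι (X : L) : envAntipode L (UniversalEnvelopingAlgebra.ι ℂ X) =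
    -UniversalEnvelopingAlgebra.ι ℂ X :=
  congrArg MulOpposite.unop (UniversalEnvelopingAlgebra.lift_ι_apply ℂ _ X)

lemma envAntipode_mul (u v : U(L)) :
    envAntipode L (u * v) = envAntipode L v * envAntipode L u :=
  congrArg MulOpposite.unop (map_mul (envAntipodeOp L) u v)

lemma envAntipode_algebraMap (r : ℂ) :
    envAntipode L (algebraMap ℂ _ r) = algebraMap ℂ _ r :=
  congrArg MulOpposite.unop ((envAntipodeOp L).commutes r)

lemma envAntipode_one : envAntipode L 1 = 1 := by
  simpa using envAntipode_algebraMap (L := L) 1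

instance : Bialgebra ℂ U(L) :=
  Bialgebra.ofAlgHom (envComul L) (envCounit L)
    (by
      refine env_algHom_ext fun X => ?_
      change Algebra.TensorProduct.assoc ℂ ℂ ℂ _ _ _
        (Algebra.TensorProduct.map (envComul L) (.id ℂ _) (envComul L (UniversalEnvelopingAlgebra.ι ℂ X))) =
        Algebra.TensorProduct.map (.id ℂ _) (envComul L)
        (envComul L (UniversalEnvelopingAlgebra.ι ℂ X))
      simp only [envComul_ι, map_add, Algebra.TensorProduct.map_tmul, map_one,
        Algebra.TensorProduct.one_def, TensorProduct.add_tmul, TensorProduct.tmul_add,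
        AlgHom.id_apply, Algebra.TensorProduct.assoc_tmul, add_assoc])
    (by
      refine env_algHom_ext fun X => ?_
      change Algebra.TensorProduct.map (envCounit L) (.id ℂ _)
        (envComul L (UniversalEnvelopingAlgebra.ι ℂ X)) =
        (Algebra.TensorProduct.lid ℂ _).symm (UniversalEnvelopingAlgebra.ι ℂ X)
      rw [envComul_ι]
      simp [-UniversalEnvelopingAlgebra.ι_apply, envCounit_ι])
    (by
      refine env_algHom_ext fun X => ?_
      change Algebra.TensorProduct.map (.id ℂ _) (envCounit L)
        (envComul L (UniversalEnvelopingAlgebra.ι ℂ X)) =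
        (Algebra.TensorProduct.rid ℂ ℂ _).symm (UniversalEnvelopingAlgebra.ι ℂ X)
      rw [envComul_ι]
      simp [-UniversalEnvelopingAlgebra.ι_apply, envCounit_ι])

lemma env_antipode_left (u : U(L)) :
    LinearMap.mul' ℂ U(L) ((envAntipode L).rTensor U(L) (envComul L u)) =
      algebraMap ℂ U(L) (envCounit L u) := by
  induction u using enveloping_induction with
  | hι X =>
    rw [envComul_ι, envCounit_ι]
    simp [-UniversalEnvelopingAlgebra.ι_apply, envAntipode_ι, envAntipode_one]
  | halg r =>
    simp [Algebra.TensorProduct.algebraMap_apply, envAntipode_algebraMap]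
  | hadd u v hu hv => simp only [map_add, hu, hv]
  | hmul u v hu hv =>
    have key : ∀ s t : U(L) ⊗[ℂ] U(L), ∀ c : ℂ,
        LinearMap.mul' ℂ U(L) ((envAntipode L).rTensor U(L) s) = algebraMap ℂ U(L) c →
        LinearMap.mul' ℂ U(L) ((envAntipode L).rTensor U(L) (s * t)) =
          algebraMap ℂ U(L) c * LinearMap.mul' ℂ U(L) ((envAntipode L).rTensor U(L) t) := by
      intro s t c hs
      have aux : ∀ (s : U(L) ⊗[ℂ] U(L)) (a b : U(L)),
          LinearMap.mul' ℂ U(L) ((envAntipode L).rTensor U(L) (s * a ⊗ₜ b)) =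
          envAntipode L a * LinearMap.mul' ℂ U(L) ((envAntipode L).rTensor U(L) s) * b := by
        intro s a b
        induction s with
        | zero => simp
        | tmul x y => simp [envAntipode_mul, mul_assoc]
        | add x y hx hy => simp only [add_mul, map_add, hx, hy, mul_add]
      induction t with
      | zero => simp
      | tmul a b =>
        rw [aux, hs]
        simp [← Algebra.commutes c, mul_assoc]
      | add x y hx hy => simp only [mul_add, map_add, hx, hy]
    rw [map_mul, key _ _ _ hu, hv, map_mul, map_mul]

lemma env_antipode_right (u : U(L)) :
    LinearMap.mul' ℂ U(L) ((envAntipode L).lTensor U(L) (envComul L u)) =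
      algebraMap ℂ U(L) (envCounit L u) := by
  induction u using enveloping_induction with
  | hι X =>
    rw [envComul_ι, envCounit_ι]
    simp [-UniversalEnvelopingAlgebra.ι_apply, envAntipode_ι, envAntipode_one]
  | halg r =>
    simp [Algebra.TensorProduct.algebraMap_apply, envAntipode_one]
  | hadd u v hu hv => simp only [map_add, hu, hv]
  | hmul u v hu hv =>
    have key : ∀ s t : U(L) ⊗[ℂ] U(L), ∀ c : ℂ,
        LinearMap.mul' ℂ U(L) ((envAntipode L).lTensor U(L) t) = algebraMap ℂ U(L) c →
        LinearMap.mul' ℂ U(L) ((envAntipode L).lTensor U(L) (s * t)) =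
          LinearMap.mul' ℂ U(L) ((envAntipode L).lTensor U(L) s) * algebraMap ℂ U(L) c := by
      intro s t c ht
      have aux : ∀ (t : U(L) ⊗[ℂ] U(L)) (a b : U(L)),
          LinearMap.mul' ℂ U(L) ((envAntipode L).lTensor U(L) (a ⊗ₜ b * t)) =
          a * LinearMap.mul' ℂ U(L) ((envAntipode L).lTensor U(L) t) * envAntipode L b := by
        intro t a b
        induction t with
        | zero => simp
        | tmul x y => simp [envAntipode_mul, mul_assoc]
        | add x y hx hy => simp only [add_mul, map_add, hx, hy, mul_add]
      induction s with
      | zero => simp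
      | tmul a b =>
        rw [aux, ht]
        simp [Algebra.commutes c, mul_assoc]
      | add x y hx hy => simp only [add_mul, map_add, hx, hy]
    rw [map_mul, key _ _ _ hv, hu, map_mul, map_mul]

/-- `U(L)` is a Hopf algebra in which the elements of `L` are primitive. -/
instance : HopfAlgebra ℂ U(L) where
  antipode := envAntipode L
  mul_antipode_rTensor_comul := LinearMap.ext env_antipode_left
  mul_antipode_lTensor_comul := LinearMap.ext env_antipode_right

end Enveloping

/-! ### The Lie algebra of an affine algebraic group -/

section LieAlg

/-- `⟨s, X ⊗ Y⟩` for functionals `X` and `Y`. -/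
def pairFun {A B : Type*} [AddCommGroup A] [Module ℂ A] [AddCommGroup B] [Module ℂ B]
    (X : A →ₗ[ℂ] ℂ) (Y : B →ₗ[ℂ] ℂ) : A ⊗[ℂ] B →ₗ[ℂ] ℂ :=
  LinearMap.mul' ℂ ℂ ∘ₗ TensorProduct.map X Y

lemma pairFun_mul {G : Type*} [Group G] [AffineAlgebraicSet G] {X Y : PolyFun G →ₗ[ℂ] ℂ}
    (hX : ∀ f g, X (f * g) = f 1 * X g + X f * g 1)
    (hY : ∀ f g, Y (f * g) = f 1 * Y g + Y f * g 1) (s t : PolyFun G ⊗[ℂ] PolyFun G) :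
    pairFun X Y (s * t) =
      pairFun (evalAt 1).toLinearMap (evalAt 1).toLinearMap s * pairFun X Y t +
      pairFun (evalAt 1).toLinearMap Y s * pairFun X (evalAt 1).toLinearMap t +
      pairFun X (evalAt 1).toLinearMap s * pairFun (evalAt 1).toLinearMap Y t +
      pairFun X Y s * pairFun (evalAt 1).toLinearMap (evalAt 1).toLinearMap t := by
  induction s with
  | zero => simp
  | add s s' hs hs' => simp only [add_mul, map_add, hs, hs']; ring
  | tmul a b =>
    induction t with
    | zero => simp
    | add t t' ht ht' => simp only [mul_add, map_add, ht, ht']; ring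
    | tmul c d =>
      simp only [pairFun, LinearMap.comp_apply, Algebra.TensorProduct.tmul_mul_tmul,
        TensorProduct.map_tmul, LinearMap.mul'_apply, hX, hY, AlgHom.toLinearMap_apply,
        evalAt_apply]
      ring

variable {G : Type*} [Group G] [AffineAlgebraicSet G] [AffineAlgebraicGroup G]

variable (G) in
/-- The Lie algebra of `G`: the point derivations of `𝒫(G)` at the identity, with the bracket
`[X, Y](f) = X(f₍₁₎) Y(f₍₂₎) - Y(f₍₁₎) X(f₍₂₎)`, i.e. the commutator of the convolution product. -/
def lieAlg : LieSubalgebra ℂ (WithConv (PolyFun G →ₗ[ℂ] ℂ)) where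
  carrier := {X | ∀ f g : PolyFun G, X.ofConv (f * g) = f 1 * X.ofConv g + X.ofConv f * g 1}
  zero_mem' := fun f g => by simp
  add_mem' := fun {X Y} hX hY f g => by
    simp only [WithConv.ofConv_add, LinearMap.add_apply, hX f g, hY f g]; ring
  smul_mem' := fun c X hX f g => by
    simp only [WithConv.ofConv_smul, LinearMap.smul_apply, hX f g, smul_eq_mul]; ring
  lie_mem' := fun {X Y} hX hY f g => by
    have c : ∀ (X Y : WithConv (PolyFun G →ₗ[ℂ] ℂ)) (f : PolyFun G), (X * Y).ofConv f =
      pairFun X.ofConv Y.ofConv (CoalgebraStruct.comul (R := ℂ) f) := fun _ _ _ => rfl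
    have l : ∀ (X : WithConv (PolyFun G →ₗ[ℂ] ℂ)) (f : PolyFun G),
        pairFun (evalAt 1).toLinearMap X.ofConv (CoalgebraStruct.comul (R := ℂ) f) = X.ofConv f :=
      fun X f => by rw [← congrArg (fun Z => Z.ofConv f) (one_mul X)]; rfl
    have r : ∀ (X : WithConv (PolyFun G →ₗ[ℂ] ℂ)) (f : PolyFun G),
        pairFun X.ofConv (evalAt 1).toLinearMap (CoalgebraStruct.comul (R := ℂ) f) = X.ofConv f :=
      fun X f => by rw [← congrArg (fun Z => Z.ofConv f) (mul_one X)]; rfl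
    rw [LieRing.of_associative_ring_bracket]
    simp only [WithConv.ofConv_sub, LinearMap.sub_apply, c, Bialgebra.comul_mul,
      pairFun_mul hX hY, pairFun_mul hY hX, l, r, AlgHom.toLinearMap_apply, evalAt_apply]
    ring

variable (G) in
/-- The Lie algebra `𝔤` of `G` as a type. -/
abbrev LieAlg : Type _ := ↥(lieAlg G)

/-- The value `X(f)` of `X ∈ 𝔤` on `f ∈ 𝒫(G)`. -/
def LieAlg.toDual : LieAlg G →ₗ[ℂ] (PolyFun G →ₗ[ℂ] ℂ) where
  toFun X := X.1.ofConv
  map_add' _ _ := rfl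
  map_smul' _ _ := rfl

lemma LieAlg.toDual_mul (X : LieAlg G) (f g : PolyFun G) :
    X.toDual (f * g) = f 1 * X.toDual g + X.toDual f * g 1 := X.2 f g

lemma LieAlg.toDual_injective : Function.Injective (LieAlg.toDual (G := G)) :=
  fun _ _ h => Subtype.ext (WithConv.ext h)

lemma LieAlg.toDual_lie (X Y : LieAlg G) (f : PolyFun G) :
    LieAlg.toDual ⁅X, Y⁆ f = pairFun X.toDual Y.toDual (CoalgebraStruct.comul (R := ℂ) f) -
      pairFun Y.toDual X.toDual (CoalgebraStruct.comul (R := ℂ) f) := rfl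

lemma LieAlg.toDual_algebraMap (X : LieAlg G) (r : ℂ) :
    X.toDual (algebraMap ℂ (PolyFun G) r) = 0 := by
  have h := X.toDual_mul 1 1
  have h1 : (1 : PolyFun G) 1 = 1 := rfl
  rw [mul_one, h1, one_mul, mul_one] at h
  rw [Algebra.algebraMap_eq_smul_one, map_smul, left_eq_add.mp h, smul_zero]

instance : FiniteDimensional ℂ (LieAlg G) := by
  have := AffineAlgebraicSet.finite_coord (X := G)
  let c : AffineAlgebraicSet.Coord G → PolyFun G := fun i =>
    PolyFun.mk (fun x => AffineAlgebraicSet.coord x i) (Algebra.subset_adjoin ⟨i, rfl⟩)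
  let T : LieAlg G →ₗ[ℂ] (AffineAlgebraicSet.Coord G → ℂ) :=
    LinearMap.pi fun i => (LinearMap.applyₗ (c i)) ∘ₗ LieAlg.toDual
  refine FiniteDimensional.of_injective T ((injective_iff_map_eq_zero T).mpr fun X hX => ?_)
  apply LieAlg.toDual_injective
  rw [map_zero]
  have key : ∀ (f : G → ℂ) (hf : f ∈ polyFun G), X.toDual (PolyFun.mk f hf) = 0 := by
    intro f hf
    induction hf using Algebra.adjoin_induction with
    | mem f hf => obtain ⟨i, rfl⟩ := hf; exact congrFun hX i
    | algebraMap r => exact X.toDual_algebraMap r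
    | add f g hf hg h1 h2 =>
      exact (map_add X.toDual (PolyFun.mk f hf) (PolyFun.mk g hg)).trans (by rw [h1, h2, add_zero])
    | mul f g hf hg h1 h2 =>
      exact (X.toDual_mul (PolyFun.mk f hf) (PolyFun.mk g hg)).trans
        (by rw [h1, h2, mul_zero, zero_mul, add_zero])
  exact LinearMap.ext fun f => key f f.mem

end LieAlg

/-! ### Matched pairs of affine algebraic groups -/

section MatchedPair

/-- A matched pair of affine algebraic groups: mutual actions `ψ ▷ φ` (left action of `G₂` on `G₁`)
and `ψ ◁ φ` (right action of `G₁` on `G₂`) that are maps of affine algebraic sets and satisfy the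
compatibility conditions. -/
structure MatchedPair (G₁ G₂ : Type*) [Group G₁] [AffineAlgebraicSet G₁] [Group G₂]
    [AffineAlgebraicSet G₂] where
  /-- `ψ ▷ φ` -/
  tri : G₂ → G₁ → G₁
  /-- `ψ ◁ φ` -/
  ltri : G₂ → G₁ → G₂
  isMorphism_tri : IsMorphism fun p : G₂ × G₁ => tri p.1 p.2
  isMorphism_ltri : IsMorphism fun p : G₂ × G₁ => ltri p.1 p.2
  one_tri : ∀ φ, tri 1 φ = φ
  mul_tri : ∀ ψ₁ ψ₂ φ, tri (ψ₁ * ψ₂) φ = tri ψ₁ (tri ψ₂ φ)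
  ltri_one : ∀ ψ, ltri ψ 1 = ψ
  ltri_mul : ∀ ψ φ₁ φ₂, ltri ψ (φ₁ * φ₂) = ltri (ltri ψ φ₁) φ₂
  tri_mul : ∀ ψ φ₁ φ₂, tri ψ (φ₁ * φ₂) = tri ψ φ₁ * tri (ltri ψ φ₁) φ₂
  tri_one : ∀ ψ, tri ψ 1 = 1
  mul_ltri : ∀ ψ₁ ψ₂ φ, ltri (ψ₁ * ψ₂) φ = ltri ψ₁ (tri ψ₂ φ) * ltri ψ₂ φ
  one_ltri : ∀ φ, ltri 1 φ = 1

/-- `f ↦ f₍₀₎ X(f₍₁₎)` for a functional `X` on `𝒫(Y)` and `f ↦ f₍₀₎ ⊗ f₍₁₎` dual to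
`φ : X × Y → Z`. -/
def partialApply {X Y Z : Type*} [AffineAlgebraicSet X] [AffineAlgebraicSet Y]
    [AffineAlgebraicSet Z] (φ : X × Y → Z) (h : IsMorphism φ) (D : PolyFun Y →ₗ[ℂ] ℂ) :
    PolyFun Z →ₗ[ℂ] PolyFun X :=
  (TensorProduct.rid ℂ (PolyFun X)).toLinearMap ∘ₗ D.lTensor (PolyFun X) ∘ₗ
    (copullback φ h).toLinearMap

lemma isMorphism_right {X Y Z : Type*} [AffineAlgebraicSet X] [AffineAlgebraicSet Y]
    [AffineAlgebraicSet Z] {φ : X × Y → Z} (h : IsMorphism φ) (x : X) :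
    IsMorphism fun y => φ (x, y) :=
  h.comp (isMorphism_prodMk (isMorphism_const x) isMorphism_id)

lemma partialApply_apply {X Y Z : Type*} [AffineAlgebraicSet X] [AffineAlgebraicSet Y]
    [AffineAlgebraicSet Z] (φ : X × Y → Z) (h : IsMorphism φ) (D : PolyFun Y →ₗ[ℂ] ℂ)
    (f : PolyFun Z) (x : X) :
    partialApply φ h D f x = D (pullback (fun y => φ (x, y)) (isMorphism_right h x) f) := by
  have h1 : ∀ t : PolyFun X ⊗[ℂ] PolyFun Y,
      evalAt x (TensorProduct.rid ℂ (PolyFun X) (D.lTensor (PolyFun X) t)) =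
        D (TensorProduct.lid ℂ (PolyFun Y) ((evalAt x).toLinearMap.rTensor _ t)) := by
    intro t
    induction t with
    | zero => simp only [map_zero]
    | tmul a b => simp [mul_comm]
    | add s t hs ht => simp only [map_add, hs, ht]
  have h2 : ∀ (t : PolyFun X ⊗[ℂ] PolyFun Y) (y : Y),
      evalAt y (TensorProduct.lid ℂ (PolyFun Y) ((evalAt x).toLinearMap.rTensor _ t)) =
        evalPair x y t := by
    intro t y
    induction t with
    | zero => simp only [map_zero]
    | tmul a b => simp
    | add s t hs ht => simp only [map_add, hs, ht]
  refine (h1 (copullback φ h f)).trans (congrArg D ?_)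
  refine PolyFun.ext fun y => ?_
  exact (h2 _ y).trans (evalPair_copullback φ h x y f)

namespace MatchedPair

variable {G₁ G₂ : Type*} [Group G₁] [AffineAlgebraicSet G₁] [AffineAlgebraicGroup G₁]
  [Group G₂] [AffineAlgebraicSet G₂] (M : MatchedPair G₁ G₂)

/-- The derived action of `𝔤₁` on `𝒫(G₂)`: `X ▷ f = f₍₀₎ X(f₍₁₎)`, where
`f₍₀₎(ψ) f₍₁₎(φ) = f (ψ ◁ φ)`. -/
def derivAct : LieAlg G₁ →ₗ⁅ℂ⁆ Module.End ℂ (PolyFun G₂) where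
  toFun X := partialApply _ M.isMorphism_ltri X.toDual
  map_add' X Y := by
    refine LinearMap.ext fun f => PolyFun.ext fun ψ => ?_
    rw [← evalAt_apply ψ (((_ : Module.End ℂ (PolyFun G₂)) + _) f), LinearMap.add_apply, map_add]
    simp only [evalAt_apply, partialApply_apply, map_add, LinearMap.add_apply]
  map_smul' c X := by
    refine LinearMap.ext fun f => PolyFun.ext fun ψ => ?_
    rw [← evalAt_apply ψ ((_ • (_ : Module.End ℂ (PolyFun G₂))) f), LinearMap.smul_apply, map_smul]
    simp only [evalAt_apply, partialApply_apply, map_smul, LinearMap.smul_apply, RingHom.id_apply]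
  map_lie' := fun {X Y} => by
    refine LinearMap.ext fun f => PolyFun.ext fun ψ => ?_
    have key : ∀ X Y : LieAlg G₁,
        partialApply _ M.isMorphism_ltri X.toDual (partialApply _ M.isMorphism_ltri Y.toDual f) ψ =
        pairFun X.toDual Y.toDual (CoalgebraStruct.comul (R := ℂ)
          (pullback _ (isMorphism_right M.isMorphism_ltri ψ) f)) := by
      intro X Y
      rw [partialApply_apply]
      have e : pullback _ (isMorphism_right M.isMorphism_ltri ψ)
          (partialApply _ M.isMorphism_ltri Y.toDual f) =
          partialApply _ AffineAlgebraicGroup.isMorphism_mul Y.toDual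
            (pullback _ (isMorphism_right M.isMorphism_ltri ψ) f) := by
        refine PolyFun.ext fun φ => ?_
        rw [pullback_apply, partialApply_apply, partialApply_apply]
        refine congrArg _ (PolyFun.ext fun φ' => ?_)
        simp only [pullback_apply, M.ltri_mul]
      rw [e]
      have h3 : ∀ t : PolyFun G₁ ⊗[ℂ] PolyFun G₁,
          X.toDual (TensorProduct.rid ℂ (PolyFun G₁) (Y.toDual.lTensor (PolyFun G₁) t)) =
          pairFun X.toDual Y.toDual t := by
        intro t
        induction t with
        | zero => simp only [map_zero]
        | tmul a b => simp [pairFun, mul_comm]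
        | add s t hs ht => simp only [map_add, hs, ht]
      exact h3 _
    rw [LieRing.of_associative_ring_bracket,
      ← evalAt_apply ψ (((_ : Module.End ℂ (PolyFun G₂)) - _) f),
      LinearMap.sub_apply, map_sub, Module.End.mul_apply, Module.End.mul_apply]
    simp only [evalAt_apply]
    rw [key, key, partialApply_apply, LieAlg.toDual_lie]

/-- The action of `U(𝔤₁)` on `𝒫(G₂)` that extends the derived action of `𝔤₁`. -/
def envAct : UniversalEnvelopingAlgebra ℂ (LieAlg G₁) →ₐ[ℂ] Module.End ℂ (PolyFun G₂) :=
  UniversalEnvelopingAlgebra.lift ℂ M.derivAct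

/-- The action of `G₂` on `𝔤₁`: `ψ ▷ X` is the image of `X` under the differential at the identity
of `φ ↦ ψ ▷ φ`, i.e. `(ψ ▷ X)(f) = X(φ ↦ f (ψ ▷ φ))`. -/
def tangentAct (ψ : G₂) : LieAlg G₁ →ₗ[ℂ] LieAlg G₁ where
  toFun X := ⟨WithConv.toConv (X.toDual ∘ₗ
    (pullback (fun φ => M.tri ψ φ) (isMorphism_right M.isMorphism_tri ψ)).toLinearMap), by
      intro f g
      simp only [LinearMap.comp_apply, AlgHom.toLinearMap_apply, map_mul,
        LieAlg.toDual_mul, pullback_apply, M.tri_one]⟩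
  map_add' _ _ := rfl
  map_smul' _ _ := rfl

lemma tangentAct_toDual (ψ : G₂) (X : LieAlg G₁) (f : PolyFun G₁) :
    (M.tangentAct ψ X).toDual f =
      X.toDual (pullback (fun φ => M.tri ψ φ) (isMorphism_right M.isMorphism_tri ψ) f) := rfl

lemma dual_tangentAct_mem (θ : Module.Dual ℂ (LieAlg G₁)) (X : LieAlg G₁) :
    (fun ψ => θ (M.tangentAct ψ X)) ∈ polyFun G₂ := by
  obtain ⟨f, hf⟩ := (LinearMap.flip_surjective_iff₁
    (B := LieAlg.toDual (G := G₁))).mpr LieAlg.toDual_injective θ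
  have : (fun ψ => θ (M.tangentAct ψ X)) =
      partialApply _ M.isMorphism_tri X.toDual f := by
    funext ψ
    rw [partialApply_apply, ← hf]
    rfl
  rw [this]
  exact PolyFun.mem _

variable {ι : Type*} [Fintype ι]

/-- The function `f_i^j ∈ 𝒫(G₂)` of a basis `X_i` of `𝔤₁`: `ψ ▷ X_i = ∑ j, f_i^j(ψ) X_j`. -/
def matrixCoeff (b : Module.Basis ι ℂ (LieAlg G₁)) (i j : ι) : PolyFun G₂ :=
  PolyFun.mk (fun ψ => b.repr (M.tangentAct ψ (b i)) j) (M.dual_tangentAct_mem (b.coord j) (b i))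

/-- The coaction `𝔤₁ → 𝔤₁ ⊗ 𝒫(G₂)`, `X_i ↦ ∑ j, X_j ⊗ f_i^j`, for a basis `X_i` of `𝔤₁`. -/
def polCoaction (b : Module.Basis ι ℂ (LieAlg G₁)) :
    LieAlg G₁ →ₗ[ℂ] LieAlg G₁ ⊗[ℂ] PolyFun G₂ :=
  b.constr ℂ fun i => ∑ j, b j ⊗ₜ[ℂ] M.matrixCoeff b i j

end MatchedPair

end MatchedPair

/-! ### Matched pairs of Hopf algebras -/

section HopfMatchedPair

open CoalgebraStruct

/-- The rule `▼(uv) = u₍₁₎₀ v₀ ⊗ u₍₁₎₁ (u₍₂₎ ▷ v₁)` for a map `▼ : U → U ⊗ F`, where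
`▼ u = u₀ ⊗ u₁`. Sums over `ℛ R u` stand for Sweedler's notation `Δ u = u₍₁₎ ⊗ u₍₂₎`. -/
def CoactionMulRule (R : Type*) {U F : Type*} [CommRing R] [Ring U] [HopfAlgebra R U] [Ring F]
    [HopfAlgebra R F] (act : U →ₗ[R] F →ₗ[R] F) (coact : U →ₗ[R] U ⊗[R] F) : Prop :=
  ∀ u v : U, coact (u * v) =
    ∑ i ∈ (ℛ R u).index, coact ((ℛ R u).left i) * (act ((ℛ R u).right i)).lTensor U (coact v)

/-- Two Hopf algebras `U` and `F` with a left action `u ▷ f = act u f` of `U` on `F` and a right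
coaction `▼ u = coact u = u₀ ⊗ u₁` of `F` on `U` form a matched pair of Hopf algebras. -/
structure IsHopfMatchedPair (R : Type*) {U F : Type*} [CommRing R] [Ring U] [HopfAlgebra R U]
    [Ring F] [HopfAlgebra R F] (act : U →ₗ[R] F →ₗ[R] F) (coact : U →ₗ[R] U ⊗[R] F) : Prop where
  /-- `1 ▷ f = f` -/
  one_act : ∀ f, act 1 f = f
  /-- `uv ▷ f = u ▷ (v ▷ f)` -/
  mul_act : ∀ u v f, act (u * v) f = act u (act v f)
  /-- `u ▷ 1 = ε(u) 1` -/
  act_one : ∀ u, act u 1 = counit (R := R) u • (1 : F)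
  /-- `u ▷ (fg) = (u₍₁₎ ▷ f) (u₍₂₎ ▷ g)` -/
  act_mul : ∀ u f g, act u (f * g) =
    ∑ i ∈ (ℛ R u).index, act ((ℛ R u).left i) f * act ((ℛ R u).right i) g
  /-- `(▼ ⊗ id) ▼ = (id ⊗ Δ) ▼` -/
  coact_coassoc : ∀ u, TensorProduct.assoc R U F F (coact.rTensor F (coact u)) =
    (comul (R := R) (A := F)).lTensor U (coact u)
  /-- `u₀ ε(u₁) = u` -/
  coact_counit : ∀ u, TensorProduct.rid R U ((counit (R := R) (A := F)).lTensor U (coact u)) = u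
  /-- `u₀₍₁₎ ⊗ u₀₍₂₎ ⊗ u₁ = u₍₁₎₀ ⊗ u₍₂₎₀ ⊗ u₍₁₎₁ u₍₂₎₁` -/
  comul_coact : ∀ u, (comul (R := R) (A := U)).rTensor F (coact u) =
    (LinearMap.mul' R F).lTensor (U ⊗[R] U)
      (TensorProduct.tensorTensorTensorComm R U F U F
        (TensorProduct.map coact coact (comul (R := R) u)))
  /-- `ε(u₀) u₁ = ε(u) 1` -/
  counit_coact : ∀ u, TensorProduct.lid R F ((counit (R := R) (A := U)).rTensor F (coact u)) =
    counit (R := R) u • (1 : F)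
  /-- `ε(u ▷ f) = ε(u) ε(f)` -/
  counit_act : ∀ u f, counit (R := R) (act u f) = counit (R := R) u * counit (R := R) f
  /-- `Δ(u ▷ f) = (u₍₁₎₀ ▷ f₍₁₎) ⊗ u₍₁₎₁ (u₍₂₎ ▷ f₍₂₎)` -/
  comul_act : ∀ u f, comul (R := R) (act u f) =
    ∑ i ∈ (ℛ R u).index, ∑ j ∈ (ℛ R f).index,
      TensorProduct.map (act.flip ((ℛ R f).left j))
        (LinearMap.mulRight R (act ((ℛ R u).right i) ((ℛ R f).right j)))
        (coact ((ℛ R u).left i))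
  /-- `▼ 1 = 1 ⊗ 1` -/
  coact_one : coact 1 = 1 ⊗ₜ[R] 1
  /-- `▼(uv) = u₍₁₎₀ v₀ ⊗ u₍₁₎₁ (u₍₂₎ ▷ v₁)` -/
  coact_mul : CoactionMulRule R act coact
  /-- `u₍₂₎₀ ⊗ (u₍₁₎ ▷ f) u₍₂₎₁ = u₍₁₎₀ ⊗ u₍₁₎₁ (u₍₂₎ ▷ f)` -/
  act_coact_comm : ∀ u f,
    ∑ i ∈ (ℛ R u).index,
      (LinearMap.mulLeft R (act ((ℛ R u).left i) f)).lTensor U (coact ((ℛ R u).right i)) =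
    ∑ i ∈ (ℛ R u).index,
      (LinearMap.mulRight R (act ((ℛ R u).right i) f)).lTensor U (coact ((ℛ R u).left i))

end HopfMatchedPair

/-- A map `▼ : U(𝔤₁) → U(𝔤₁) ⊗ 𝒫(G₂)` is the extension of the coaction of `𝒫(G₂)` on `𝔤₁`
if it restricts to it on `𝔤₁`, `▼ 1 = 1 ⊗ 1` and `▼(uv) = u₍₁₎₀ v₀ ⊗ u₍₁₎₁ (u₍₂₎ ▷ v₁)`. -/
structure MatchedPair.IsEnvCoaction {G₁ G₂ : Type*} [Group G₁] [AffineAlgebraicSet G₁]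
    [AffineAlgebraicGroup G₁] [Group G₂] [AffineAlgebraicSet G₂] [AffineAlgebraicGroup G₂]
    (M : MatchedPair G₁ G₂) {ι : Type*} [Fintype ι] (b : Module.Basis ι ℂ (LieAlg G₁))
    (coact : UniversalEnvelopingAlgebra ℂ (LieAlg G₁) →ₗ[ℂ]
      UniversalEnvelopingAlgebra ℂ (LieAlg G₁) ⊗[ℂ] PolyFun G₂) : Prop where
  coact_ι : ∀ X : LieAlg G₁, coact (UniversalEnvelopingAlgebra.ι ℂ X) =
    (UniversalEnvelopingAlgebra.ι ℂ (L := LieAlg G₁)).toLinearMap.rTensor (PolyFun G₂)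
      (M.polCoaction b X)
  coact_one : coact 1 = 1 ⊗ₜ[ℂ] 1
  coact_mul : CoactionMulRule ℂ M.envAct.toLinearMap coact

end AlgGroup

end

noncomputable section

namespace AlgGroup

attribute [local instance 100] LieRing.ofAssociativeRing

open CoalgebraStruct

local notation "U(" L ")" => UniversalEnvelopingAlgebra ℂ L

/-! Everything is reduced to statements about 𝔤₁. An identity linear in u ∈ U(L) holds once it holds
at u = 1 and both sides change in the same way under u ↦ Xu with X ∈ L
(`enveloping_induction_left`). The conditions on X that this needs are collected in `LieHopfPair`.

At u = X the product rule reads ▼(Xv) = ▼X · ▼v + (id ⊗ X ▷ ·)▼v. Hence ▼ is determined by its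
restriction to L (`eq_coact`), and it has to be u ↦ u · 1 for the operators T_X = (▼X ·) + (id ⊗ X ▷
·) on U(L) ⊗ F. The bracket condition `lieCoact_lie` says exactly that X ↦ T_X represents L
(`twist`), which gives existence. Each remaining axiom compares two solutions of one recursion in X.
The main cases are `comul_act`, `coact_mul`, `coact_coassoc` and `comul_coact`. The exception is the
exchange condition `act_coact_comm`, which holds because U(L) is cocommutative and F is commutative.

For a matched pair of groups, the conditions on X are the axioms differentiated at the identity of
G₁. They may be checked at points, because points separate tensors of polynomial functions. A
variable φ that occurs twice is treated by the Leibniz rule `LieAlg.toDual_diag`. The formula for ψ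
▷ (φφ') gives the bracket condition (`tangentAct_lie`), and the formula for (ψ₁ψ₂) ◁ φ gives the
coproduct condition (`comul_derivAct`). -/

/-- To prove a linear property of all elements of `U(L)`, prove it for `1` and show that it is
stable under left multiplication by elements of `L`. -/
lemma enveloping_induction_left {L : Type*} [LieRing L] [LieAlgebra ℂ L] {P : U(L) → Prop}
    (one : P 1) (add : ∀ u v, P u → P v → P (u + v)) (smul : ∀ (c : ℂ) u, P u → P (c • u))
    (mul : ∀ X u, P u → P (UniversalEnvelopingAlgebra.ι ℂ X * u)) (u : U(L)) : P u := by
  suffices h : ∀ v, P v → P (u * v) by simpa only [mul_one] using h 1 one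
  induction u using enveloping_induction with
  | hι X => exact mul X
  | halg r => exact fun v hv => by rw [← Algebra.smul_def]; exact smul r v hv
  | hadd u w hu hw => exact fun v hv => by rw [add_mul]; exact add _ _ (hu v hv) (hw v hv)
  | hmul u w hu hw => exact fun v hv => by rw [mul_assoc]; exact hu _ (hw v hv)

/-- A sum over a representation of `Δ u` is the value at `Δ u` of the induced linear map. -/
lemma sum_repr_eq {R C V : Type*} [CommSemiring R] [AddCommMonoid C] [Module R C]
    [CoalgebraStruct R C] [AddCommMonoid V] [Module R V] (B : C ⊗[R] C →ₗ[R] V) (u : C) :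
    ∑ i ∈ (ℛ R u).index, B ((ℛ R u).left i ⊗ₜ (ℛ R u).right i) = B (comul u) := by
  rw [← map_sum, (ℛ R u).eq]

/-- Commutativity of A plays no role, as D acts on the second factor only. -/
lemma lTensor_derivation {A F : Type*} [Ring A] [Algebra ℂ A] [CommRing F] [Algebra ℂ F]
    {D : Module.End ℂ F} (hD : ∀ f g, D (f * g) = D f * g + f * D g) (s t : A ⊗[ℂ] F) :
    D.lTensor A (s * t) = D.lTensor A s * t + s * D.lTensor A t := by
  induction s with
  | zero => simp
  | add s s' hs hs' => simp only [add_mul, map_add, hs, hs']; abel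
  | tmul a f =>
    induction t with
    | zero => simp
    | add t t' ht ht' => simp only [mul_add, map_add, ht, ht']; abel
    | tmul b g =>
      simp only [Algebra.TensorProduct.tmul_mul_tmul, LinearMap.lTensor_tmul, hD,
        TensorProduct.tmul_add]

/-! ### Infinitesimal matched pairs -/

/-- An action by derivations of a Lie algebra `L` on a commutative Hopf algebra `F` and a coaction
`X ↦ X₀ ⊗ X₁` of `F` on `L` that are compatible, so that they extend to a matched pair of the Hopf
algebras `U(L)` and `F`. -/
structure LieHopfPair (L F : Type*) [LieRing L] [LieAlgebra ℂ L] [CommRing F]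
    [HopfAlgebra ℂ F] where
  /-- `X ▷ f` -/
  der : L →ₗ⁅ℂ⁆ Module.End ℂ F
  /-- `X₀ ⊗ X₁` -/
  lieCoact : L →ₗ[ℂ] L ⊗[ℂ] F
  der_mul : ∀ X f g, der X (f * g) = der X f * g + f * der X g
  counit_der : ∀ X f, counit (R := ℂ) (der X f) = 0
  lieCoact_coassoc : ∀ X, TensorProduct.assoc ℂ L F F (lieCoact.rTensor F (lieCoact X)) =
    (comul (R := ℂ) (A := F)).lTensor L (lieCoact X)
  lieCoact_counit : ∀ X,
    TensorProduct.rid ℂ L ((counit (R := ℂ) (A := F)).lTensor L (lieCoact X)) = X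
  /-- `Δ(X ▷ f) = (X₀ ▷ f₍₁₎) ⊗ X₁ f₍₂₎ + f₍₁₎ ⊗ (X ▷ f₍₂₎)` -/
  comul_der : ∀ X f, comul (R := ℂ) (der X f) =
    TensorProduct.homTensorHomMap (.id ℂ) F F F F
      (TensorProduct.map der.toLinearMap (LinearMap.mul ℂ F) (lieCoact X)) (comul f) +
    (der X).lTensor F (comul f)
  /-- `▼[X, Y] = [▼X, ▼Y] + (id ⊗ X ▷ ·)▼Y - (id ⊗ Y ▷ ·)▼X` -/
  lieCoact_lie : ∀ X Y,
    (UniversalEnvelopingAlgebra.ι ℂ (L := L)).toLinearMap.rTensor F (lieCoact ⁅X, Y⁆) =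
    ⁅(UniversalEnvelopingAlgebra.ι ℂ (L := L)).toLinearMap.rTensor F (lieCoact X),
      (UniversalEnvelopingAlgebra.ι ℂ (L := L)).toLinearMap.rTensor F (lieCoact Y)⁆ +
    ((UniversalEnvelopingAlgebra.ι ℂ (L := L)).toLinearMap.rTensor F
      ((der X).lTensor L (lieCoact Y)) -
    (UniversalEnvelopingAlgebra.ι ℂ (L := L)).toLinearMap.rTensor F
      ((der Y).lTensor L (lieCoact X)))

namespace LieHopfPair

variable {L F : Type*} [LieRing L] [LieAlgebra ℂ L] [CommRing F] [HopfAlgebra ℂ F]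
  (P : LieHopfPair L F)

/-- The action of `U(L)` on `F`. -/
def act : U(L) →ₐ[ℂ] Module.End ℂ F := UniversalEnvelopingAlgebra.lift ℂ P.der

lemma act_ι (X : L) : P.act (UniversalEnvelopingAlgebra.ι ℂ X) = P.der X :=
  UniversalEnvelopingAlgebra.lift_ι_apply ℂ _ X

variable (L F) in
/-- The inclusion `L ⊗ F → U(L) ⊗ F`. -/
def incl : L ⊗[ℂ] F →ₗ[ℂ] U(L) ⊗[ℂ] F :=
  (UniversalEnvelopingAlgebra.ι ℂ (L := L)).toLinearMap.rTensor F

lemma incl_tmul (X : L) (f : F) :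
    incl L F (X ⊗ₜ f) = UniversalEnvelopingAlgebra.ι ℂ X ⊗ₜ f := rfl

/-- The coaction on `L` with values in `U(L) ⊗ F`. -/
def base : L →ₗ[ℂ] U(L) ⊗[ℂ] F := incl L F ∘ₗ P.lieCoact

lemma base_apply (X : L) : P.base X = incl L F (P.lieCoact X) := rfl

lemma incl_lTensor (D : Module.End ℂ F) (t : L ⊗[ℂ] F) :
    incl L F (D.lTensor L t) = D.lTensor U(L) (incl L F t) := by
  induction t with
  | zero => simp
  | add s t hs ht => simp only [map_add, hs, ht]
  | tmul X f => rfl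

/-- The bracket condition, moved to U(L) ⊗ F, where the coactions can be multiplied. -/
lemma base_lie (X Y : L) : P.base ⁅X, Y⁆ = P.base X * P.base Y - P.base Y * P.base X +
    ((P.der X).lTensor U(L) (P.base Y) - (P.der Y).lTensor U(L) (P.base X)) := by
  rw [base_apply, base_apply, base_apply, ← incl_lTensor, ← incl_lTensor]
  exact P.lieCoact_lie X Y

/-! ### Construction of the coaction on U(L) -/

/-- The Lie algebra `L` acts on `U(L) ⊗ F` by `X ↦ ▼X · + (id ⊗ X ▷ ·)`. -/
def twist : L →ₗ⁅ℂ⁆ Module.End ℂ (U(L) ⊗[ℂ] F) where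
  toFun X := LinearMap.mulLeft ℂ (P.base X) + (P.der X).lTensor U(L)
  map_add' X Y := by
    refine LinearMap.ext fun w => ?_
    simp only [map_add, LinearMap.lTensor_add, LinearMap.add_apply, LinearMap.mulLeft_apply,
      add_mul]
    abel
  map_smul' c X := by
    refine LinearMap.ext fun w => ?_
    simp only [map_smul, LinearMap.lTensor_smul, LinearMap.add_apply, LinearMap.mulLeft_apply,
      LinearMap.smul_apply, smul_mul_assoc, smul_add, RingHom.id_apply]
  map_lie' := fun {X Y} => by
    refine LinearMap.ext fun w => ?_
    -- With a = ▼X, b = ▼Y and derivations D, E coming from X, Y, the commutator of (a ·) + D and (b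
    -- ·) + E is left multiplication by ab - ba + Db - Ea, plus [D, E]. By `base_lie` that element
    -- is ▼[X, Y].
    simp only [LieRing.of_associative_ring_bracket, LieHom.map_lie, LinearMap.lTensor_sub,
      LinearMap.lTensor_mul, LinearMap.add_apply, LinearMap.sub_apply, Module.End.mul_apply,
      LinearMap.mulLeft_apply, map_add, base_lie, lTensor_derivation (P.der_mul _)]
    noncomm_ring

/-- The coaction `U(L) → U(L) ⊗ F`. -/
def coact : U(L) →ₗ[ℂ] U(L) ⊗[ℂ] F :=
  LinearMap.applyₗ 1 ∘ₗ (UniversalEnvelopingAlgebra.lift ℂ P.twist).toLinearMap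

lemma coact_one : P.coact 1 = 1 := by
  exact LinearMap.congr_fun (map_one (UniversalEnvelopingAlgebra.lift ℂ P.twist)) 1

/-- The recursion behind all later inductions: Xu acts on 1 as X acts on u · 1. -/
lemma coact_ι_mul (X : L) (u : U(L)) : P.coact (UniversalEnvelopingAlgebra.ι ℂ X * u) =
    P.base X * P.coact u + (P.der X).lTensor U(L) (P.coact u) := by
  change UniversalEnvelopingAlgebra.lift ℂ P.twist (_ * u) 1 = _
  rw [map_mul, UniversalEnvelopingAlgebra.lift_ι_apply]
  rfl

lemma der_one (X : L) : P.der X 1 = 0 := by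
  have h := P.der_mul X 1 1
  rw [mul_one, mul_one, one_mul] at h
  exact left_eq_add.mp h

lemma coact_ι (X : L) : P.coact (UniversalEnvelopingAlgebra.ι ℂ X) = P.base X := by
  rw [← mul_one (UniversalEnvelopingAlgebra.ι ℂ X), coact_ι_mul, coact_one,
    Algebra.TensorProduct.one_def, LinearMap.lTensor_tmul, der_one, TensorProduct.tmul_zero,
    add_zero, ← Algebra.TensorProduct.one_def, mul_one]

lemma comul_ι (X : L) : comul (R := ℂ) (UniversalEnvelopingAlgebra.ι ℂ X) =
    UniversalEnvelopingAlgebra.ι ℂ X ⊗ₜ[ℂ] 1 + 1 ⊗ₜ UniversalEnvelopingAlgebra.ι ℂ X :=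
  envComul_ι X

lemma counit_ι (X : L) : counit (R := ℂ) (UniversalEnvelopingAlgebra.ι ℂ X) = 0 :=
  envCounit_ι X

lemma comul_ι_mul (X : L) (u : U(L)) :
    comul (R := ℂ) (UniversalEnvelopingAlgebra.ι ℂ X * u) =
    (UniversalEnvelopingAlgebra.ι ℂ X ⊗ₜ[ℂ] 1 + 1 ⊗ₜ UniversalEnvelopingAlgebra.ι ℂ X) *
      comul u := by
  rw [Bialgebra.comul_mul, comul_ι]

lemma counit_ι_mul (X : L) (u : U(L)) :
    counit (R := ℂ) (UniversalEnvelopingAlgebra.ι ℂ X * u) = 0 := by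
  rw [Bialgebra.counit_mul, counit_ι, zero_mul]

/-! ### Operators C(▼u₍₁₎) θ(u₍₂₎) and their recursion -/

section Smash

variable {V : Type*} [AddCommGroup V] [Module ℂ V] (C : U(L) ⊗[ℂ] F →ₐ[ℂ] Module.End ℂ V)
  (θ : U(L) →ₐ[ℂ] Module.End ℂ V)

/-- `u ⊗ v ↦ C(▼u) θ(v)`. -/
def smash : U(L) ⊗[ℂ] U(L) →ₗ[ℂ] Module.End ℂ V :=
  LinearMap.mul' ℂ _ ∘ₗ TensorProduct.map (C.toLinearMap ∘ₗ P.coact) θ.toLinearMap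

lemma smash_tmul (u v : U(L)) : P.smash C θ (u ⊗ₜ v) = C (P.coact u) * θ v := rfl

/-- In Δ(Xu) = (X ⊗ 1 + 1 ⊗ X) Δu, the term X ⊗ 1 yields C(▼X) C(▼v) θ(w) + C((id ⊗ X ▷ ·)▼v) θ(w),
and the term 1 ⊗ X yields C(▼v) θ(X) θ(w). By `hC` the last two combine to θ(X) C(▼v) θ(w). This
serves both `comul_act` and `coact_mul`. -/
lemma smash_comul_ι_mul (hC : ∀ X w, θ (UniversalEnvelopingAlgebra.ι ℂ X) * C w =
      C ((P.der X).lTensor U(L) w) + C w * θ (UniversalEnvelopingAlgebra.ι ℂ X)) (X : L)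
    (u : U(L)) :
    P.smash C θ (comul (R := ℂ) (UniversalEnvelopingAlgebra.ι ℂ X * u)) =
      (C (P.base X) + θ (UniversalEnvelopingAlgebra.ι ℂ X)) * P.smash C θ (comul (R := ℂ) u) := by
  rw [comul_ι_mul]
  generalize comul (R := ℂ) u = t
  induction t with
  | zero => simp
  | add s t hs ht => simp only [mul_add, map_add, hs, ht]
  | tmul v w =>
    rw [add_mul, Algebra.TensorProduct.tmul_mul_tmul, Algebra.TensorProduct.tmul_mul_tmul,
      one_mul, one_mul, map_add, smash_tmul, smash_tmul, smash_tmul, coact_ι_mul, map_add,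
      map_mul, map_mul, ← mul_assoc, add_mul _ _ (C (P.coact v) * θ w), ← mul_assoc, ← mul_assoc,
      hC]
    noncomm_ring

lemma smash_comul_one : P.smash C θ (comul (R := ℂ) 1) = 1 := by
  rw [Bialgebra.comul_one, Algebra.TensorProduct.one_def, smash_tmul, coact_one, map_one, map_one,
    one_mul]

end Smash

/-! ### Axioms for the action on F -/

section Action

lemma act_ι_mul (X : L) (u : U(L)) (f : F) :
    P.act (UniversalEnvelopingAlgebra.ι ℂ X * u) f = P.der X (P.act u f) := by
  rw [map_mul, act_ι, Module.End.mul_apply]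

lemma act_one (u : U(L)) : P.act u 1 = counit (R := ℂ) u • (1 : F) := by
  induction u using enveloping_induction_left with
  | one => rw [Bialgebra.counit_one, one_smul, map_one P.act, Module.End.one_apply]
  | add u v hu hv => simp only [map_add, LinearMap.add_apply, hu, hv, add_smul]
  | smul c u hu => simp only [map_smul, LinearMap.smul_apply, hu, smul_assoc]
  | mul X u hu => rw [act_ι_mul, hu, map_smul, der_one, smul_zero, counit_ι_mul, zero_smul]

lemma counit_act (u : U(L)) (f : F) :
    counit (R := ℂ) (P.act u f) = counit (R := ℂ) u * counit (R := ℂ) f := by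
  induction u using enveloping_induction_left with
  | one => rw [map_one, Bialgebra.counit_one, one_mul, Module.End.one_apply]
  | add u v hu hv => simp only [map_add, LinearMap.add_apply, hu, hv, add_mul]
  | smul c u hu => simp only [map_smul, LinearMap.smul_apply, hu, smul_mul_assoc]
  | mul X u hu => rw [act_ι_mul, counit_der, counit_ι_mul, zero_mul]

/-- The action of `U(L) ⊗ U(L)` on `F ⊗ F`. -/
def actTensor : U(L) ⊗[ℂ] U(L) →ₐ[ℂ] Module.End ℂ (F ⊗[ℂ] F) :=
  (Module.endTensorEndAlgHom (R := ℂ) (S := ℂ) (A := ℂ)).comp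
    (Algebra.TensorProduct.map P.act P.act)

lemma actTensor_tmul (u v : U(L)) (f g : F) :
    P.actTensor (u ⊗ₜ v) (f ⊗ₜ g) = P.act u f ⊗ₜ P.act v g := rfl

/-- Multiplication F ⊗ F → F intertwines X ⊗ 1 + 1 ⊗ X with X, which is the Leibniz rule. -/
lemma act_mul' (u : U(L)) (t : F ⊗[ℂ] F) : P.act u (LinearMap.mul' ℂ F t) =
    LinearMap.mul' ℂ F (P.actTensor (comul (R := ℂ) u) t) := by
  induction u using enveloping_induction_left with
  | one => rw [Bialgebra.comul_one, map_one, map_one, Module.End.one_apply, Module.End.one_apply]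
  | add u v hu hv => simp only [map_add, LinearMap.add_apply, hu, hv]
  | smul c u hu => simp only [map_smul, LinearMap.smul_apply, hu]
  | mul X u hu =>
    rw [act_ι_mul, hu, comul_ι_mul, map_mul, Module.End.mul_apply]
    generalize P.actTensor (comul (R := ℂ) u) t = s
    induction s with
    | zero => simp only [map_zero]
    | add s t hs ht => simp only [map_add, hs, ht]
    | tmul f g =>
      rw [map_add, LinearMap.add_apply, actTensor_tmul, actTensor_tmul, map_one, map_add, act_ι]
      simp only [LinearMap.mul'_apply, Module.End.one_apply, der_mul]

/-- The action `w ⊗ h ↦ (w ▷ ·) ⊗ (h ·)` of `U(L) ⊗ F` on `F ⊗ F`. -/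
def actMul : U(L) ⊗[ℂ] F →ₐ[ℂ] Module.End ℂ (F ⊗[ℂ] F) :=
  (Module.endTensorEndAlgHom (R := ℂ) (S := ℂ) (A := ℂ)).comp
    (Algebra.TensorProduct.map P.act (Algebra.lmul ℂ F))

lemma actMul_tmul (u : U(L)) (h f g : F) :
    P.actMul (u ⊗ₜ h) (f ⊗ₜ g) = P.act u f ⊗ₜ (h * g) := rfl

lemma actMul_apply_tmul (w : U(L) ⊗[ℂ] F) (f g : F) : P.actMul w (f ⊗ₜ g) =
    TensorProduct.map (P.act.toLinearMap.flip f) (LinearMap.mulRight ℂ g) w := by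
  induction w with
  | zero => simp
  | add s t hs ht => simp only [map_add, LinearMap.add_apply, hs, ht]
  | tmul u h => rfl

/-- Links `actMul` to the form in which `comul_der` is stated. -/
lemma actMul_incl (t : L ⊗[ℂ] F) : P.actMul (incl L F t) =
    TensorProduct.homTensorHomMap (.id ℂ) F F F F
      (TensorProduct.map P.der.toLinearMap (LinearMap.mul ℂ F) t) := by
  induction t with
  | zero => simp
  | add s t hs ht => simp only [map_add, hs, ht]
  | tmul X f =>
    refine TensorProduct.ext' fun g h => ?_
    rw [incl_tmul, actMul_tmul, act_ι]
    rfl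

/-- The action of `U(L)` on the second factor of `A ⊗ F`. -/
def actRight (A : Type*) [AddCommGroup A] [Module ℂ A] : U(L) →ₐ[ℂ] Module.End ℂ (A ⊗[ℂ] F) :=
  (Module.End.lTensorAlgHom ℂ F A).comp P.act

lemma actRight_apply (A : Type*) [AddCommGroup A] [Module ℂ A] (u : U(L)) :
    P.actRight A u = (P.act u).lTensor A := rfl

/-- The hypothesis `hC` of `smash_comul_ι_mul` for the action on F ⊗ F: the Leibniz rule for X on a
product hg in the second factor. -/
lemma actRight_mul_actMul (X : L) (w : U(L) ⊗[ℂ] F) :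
    P.actRight F (UniversalEnvelopingAlgebra.ι ℂ X) * P.actMul w =
      P.actMul ((P.der X).lTensor U(L) w) +
        P.actMul w * P.actRight F (UniversalEnvelopingAlgebra.ι ℂ X) := by
  refine TensorProduct.ext' fun f g => ?_
  rw [actRight_apply, act_ι, LinearMap.add_apply, Module.End.mul_apply, Module.End.mul_apply,
    LinearMap.lTensor_tmul]
  induction w with
  | zero => simp
  | add s t hs ht => simp only [map_add, LinearMap.add_apply, hs, ht]; abel
  | tmul u h =>
    rw [LinearMap.lTensor_tmul, actMul_tmul, actMul_tmul, actMul_tmul, LinearMap.lTensor_tmul,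
      der_mul, TensorProduct.tmul_add]

/-- Applying X multiplies the right side by C(▼X) + θ(X), by `smash_comul_ι_mul`. The left side
obeys the same rule by `comul_der`. -/
lemma comul_act (u : U(L)) (f : F) : comul (R := ℂ) (P.act u f) =
    P.smash P.actMul (P.actRight F) (comul (R := ℂ) u) (comul (R := ℂ) f) := by
  induction u using enveloping_induction_left with
  | one => rw [smash_comul_one, map_one]; rfl
  | add u v hu hv => simp only [map_add, LinearMap.add_apply, hu, hv]
  | smul c u hu => simp only [map_smul, LinearMap.smul_apply, hu]
  | mul X u hu =>
    rw [act_ι_mul, comul_der, hu, smash_comul_ι_mul _ _ _ P.actRight_mul_actMul,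
      Module.End.mul_apply, LinearMap.add_apply, base_apply, actMul_incl, actRight_apply, act_ι]

end Action

/-! ### Axioms for the coaction on U(L) -/

section Coaction

/-- Here C is left multiplication on U(L) ⊗ F, so `hC` says that id ⊗ X is a derivation. -/
lemma coact_mul (u v : U(L)) : P.coact (u * v) =
    P.smash (Algebra.lmul ℂ _) (P.actRight U(L)) (comul (R := ℂ) u) (P.coact v) := by
  induction u using enveloping_induction_left with
  | one => rw [smash_comul_one, one_mul]; rfl
  | add u v hu hv => simp only [add_mul, map_add, LinearMap.add_apply, hu, hv]
  | smul c u hu => simp only [smul_mul_assoc, map_smul, LinearMap.smul_apply, hu]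
  | mul X u hu =>
    rw [mul_assoc, coact_ι_mul, hu, smash_comul_ι_mul, Module.End.mul_apply, LinearMap.add_apply,
      actRight_apply, act_ι]
    · rfl
    · intro X w
      refine LinearMap.ext fun w' => ?_
      rw [actRight_apply, act_ι]
      exact lTensor_derivation (P.der_mul X) w w'

/-- Removes the chosen representation of Δu, leaving an expression linear in Δu. -/
lemma coactionMulRule_iff (coact' : U(L) →ₗ[ℂ] U(L) ⊗[ℂ] F) :
    CoactionMulRule ℂ P.act.toLinearMap coact' ↔ ∀ u v, coact' (u * v) =
      LinearMap.mul' ℂ _ (TensorProduct.map coact'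
        (LinearMap.applyₗ (coact' v) ∘ₗ (P.actRight U(L)).toLinearMap) (comul (R := ℂ) u)) := by
  refine forall₂_congr fun u v => ?_
  rw [← LinearMap.comp_apply, ← sum_repr_eq]
  rfl

lemma coactionMulRule_coact : CoactionMulRule ℂ P.act.toLinearMap P.coact := by
  refine (P.coactionMulRule_iff _).mpr fun u v => ?_
  rw [coact_mul]
  generalize comul (R := ℂ) u = t
  induction t with
  | zero => simp
  | add s t hs ht => simp only [map_add, LinearMap.add_apply, hs, ht]
  | tmul a b => rfl

/-- Since X is primitive and ▼1 = 1, the product rule at X is the recursion `coact_ι_mul`. -/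
lemma eq_coact {coact' : U(L) →ₗ[ℂ] U(L) ⊗[ℂ] F} (h1 : coact' 1 = 1)
    (hι : ∀ X, coact' (UniversalEnvelopingAlgebra.ι ℂ X) = P.base X)
    (hmul : CoactionMulRule ℂ P.act.toLinearMap coact') : coact' = P.coact := by
  rw [coactionMulRule_iff] at hmul
  refine LinearMap.ext fun u => ?_
  induction u using enveloping_induction_left with
  | one => rw [h1, coact_one]
  | add u v hu hv => simp only [map_add, hu, hv]
  | smul c u hu => simp only [map_smul, hu]
  | mul X u hu =>
    rw [hmul, coact_ι_mul, comul_ι, map_add, map_add, TensorProduct.map_tmul,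
      TensorProduct.map_tmul, LinearMap.mul'_apply, LinearMap.mul'_apply, h1, hι, hu, one_mul]
    simp only [LinearMap.comp_apply, AlgHom.toLinearMap_apply, map_one,
      LinearMap.applyₗ_apply_apply, actRight_apply, act_ι, Module.End.one_apply]

/-- Δ is multiplicative, the flip is an algebra map, and ΔX is symmetric. -/
lemma comm_comul (u : U(L)) :
    TensorProduct.comm ℂ U(L) U(L) (comul (R := ℂ) u) = comul (R := ℂ) u := by
  induction u using enveloping_induction_left with
  | one => rw [Bialgebra.comul_one]; rfl
  | add u v hu hv => simp only [map_add, hu, hv]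
  | smul c u hu => simp only [map_smul, hu]
  | mul X u hu =>
    rw [comul_ι_mul]
    conv_rhs => rw [← hu]
    refine (map_mul (Algebra.TensorProduct.comm ℂ U(L) U(L)) _ _).trans ?_
    refine congrArg₂ _ ?_ rfl
    rw [map_add, Algebra.TensorProduct.comm_tmul, Algebra.TensorProduct.comm_tmul, add_comm]

lemma act_coact_comm (u : U(L)) (f : F) :
    ∑ i ∈ (ℛ ℂ u).index, (LinearMap.mulLeft ℂ (P.act ((ℛ ℂ u).left i) f)).lTensor U(L)
      (P.coact ((ℛ ℂ u).right i)) =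
    ∑ i ∈ (ℛ ℂ u).index, (LinearMap.mulRight ℂ (P.act ((ℛ ℂ u).right i) f)).lTensor U(L)
      (P.coact ((ℛ ℂ u).left i)) := by
  let B : U(L) ⊗[ℂ] U(L) →ₗ[ℂ] U(L) ⊗[ℂ] F := TensorProduct.lift
    ((LinearMap.lTensorHom U(L) ∘ₗ LinearMap.mul ℂ F ∘ₗ P.act.toLinearMap.flip f).compl₂ P.coact)
  refine (sum_repr_eq B u).trans ?_
  -- Cocommutativity of U(L) swaps u₍₁₎ and u₍₂₎; commutativity of F then turns left multiplication
  -- into right multiplication.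
  rw [← comm_comul]
  refine (sum_repr_eq (B ∘ₗ (TensorProduct.comm ℂ U(L) U(L)).toLinearMap) u).symm.trans ?_
  refine Finset.sum_congr rfl fun i _ => ?_
  rw [show LinearMap.mulRight ℂ (P.act ((ℛ ℂ u).right i) f) = LinearMap.mulLeft ℂ _ from
    LinearMap.ext fun _ => mul_comm _ _]
  rfl

lemma coact_counit (u : U(L)) :
    TensorProduct.rid ℂ U(L) ((counit (R := ℂ) (A := F)).lTensor U(L) (P.coact u)) = u := by
  -- Seen as an algebra map, id ⊗ ε passes through the product in the recursion, and it kills the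
  -- derivation term because ε(X ▷ f) = 0.
  let π : U(L) ⊗[ℂ] F →ₐ[ℂ] U(L) := (Algebra.TensorProduct.rid ℂ ℂ U(L)).toAlgHom.comp
    (Algebra.TensorProduct.map (.id ℂ _) (Bialgebra.counitAlgHom ℂ F))
  change π (P.coact u) = u
  induction u using enveloping_induction_left with
  | one => rw [coact_one, map_one]
  | add u v hu hv => simp only [map_add, hu, hv]
  | smul c u hu => simp only [map_smul, hu]
  | mul X u hu =>
    have h1 : π (P.base X) = UniversalEnvelopingAlgebra.ι ℂ X := by
      have h : ∀ t, π (incl L F t) = UniversalEnvelopingAlgebra.ι ℂ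
          (TensorProduct.rid ℂ L ((counit (R := ℂ) (A := F)).lTensor L t)) := by
        intro t
        induction t with
        | zero => simp only [map_zero]
        | add s t hs ht => simp only [map_add, hs, ht]
        | tmul Y f =>
          rw [LinearMap.lTensor_tmul, TensorProduct.rid_tmul, map_smul]
          rfl
      rw [base_apply, h, lieCoact_counit]
    have h2 : ∀ w, π ((P.der X).lTensor U(L) w) = 0 := by
      intro w
      induction w with
      | zero => simp only [map_zero]
      | add s t hs ht => simp only [map_add, hs, ht, add_zero]
      | tmul v f =>
        change counit (R := ℂ) (P.der X f) • v = 0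
        rw [counit_der, zero_smul]
    rw [coact_ι_mul, map_add, h2, map_mul, h1, hu, add_zero]

lemma counit_coact (u : U(L)) :
    TensorProduct.lid ℂ F ((counit (R := ℂ) (A := U(L))).rTensor F (P.coact u)) =
    counit (R := ℂ) u • (1 : F) := by
  -- The algebra map ε ⊗ id kills ▼X, because ε vanishes on L, and it commutes with X. What remains
  -- is X ▷ ε(u)1 = 0.
  let π : U(L) ⊗[ℂ] F →ₐ[ℂ] F := (Algebra.TensorProduct.lid ℂ F).toAlgHom.comp
    (Algebra.TensorProduct.map (Bialgebra.counitAlgHom ℂ U(L)) (.id ℂ F))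
  change π (P.coact u) = _
  induction u using enveloping_induction_left with
  | one => rw [coact_one, map_one, Bialgebra.counit_one, one_smul]
  | add u v hu hv => simp only [map_add, hu, hv, add_smul]
  | smul c u hu => simp only [map_smul, hu, smul_assoc]
  | mul X u hu =>
    have h1 : ∀ t, π (incl L F t) = 0 := by
      intro t
      induction t with
      | zero => simp only [map_zero]
      | add s t hs ht => simp only [map_add, hs, ht, add_zero]
      | tmul Y f =>
        change counit (R := ℂ) (UniversalEnvelopingAlgebra.ι ℂ Y) • f = 0
        rw [counit_ι, zero_smul]
    have h2 : ∀ w, π ((P.der X).lTensor U(L) w) = P.der X (π w) := by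
      intro w
      induction w with
      | zero => simp only [map_zero]
      | add s t hs ht => simp only [map_add, hs, ht]
      | tmul v f => exact (map_smul (P.der X) (counit (R := ℂ) v) f).symm
    rw [coact_ι_mul, map_add, h2, map_mul, base_apply, h1, hu, map_smul, der_one, counit_ι_mul,
      zero_smul, smul_zero, zero_mul, add_zero]

/-- For Y ⊗ h and v ⊗ g the product is Yv ⊗ hg, and ▼(Yv) has two terms. In the derivation term Y
acts on the middle factor while h multiplies the last one, which is `actMul (Y ⊗ h)`. -/
lemma assoc_rTensor_coact_incl_mul (t : L ⊗[ℂ] F) (w : U(L) ⊗[ℂ] F) :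
    Algebra.TensorProduct.assoc ℂ ℂ ℂ U(L) F F (P.coact.rTensor F (incl L F t * w)) =
    Algebra.TensorProduct.assoc ℂ ℂ ℂ U(L) F F (P.base.rTensor F t) *
      Algebra.TensorProduct.assoc ℂ ℂ ℂ U(L) F F (P.coact.rTensor F w) +
    (P.actMul (incl L F t)).lTensor U(L)
      (Algebra.TensorProduct.assoc ℂ ℂ ℂ U(L) F F (P.coact.rTensor F w)) := by
  induction t with
  | zero => simp
  | add s t hs ht =>
    simp only [map_add, add_mul, LinearMap.lTensor_add, LinearMap.add_apply, hs, ht]; abel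
  | tmul Y h =>
    induction w with
    | zero => simp
    | add s t hs ht => simp only [map_add, mul_add, hs, ht]; abel
    | tmul v g =>
      rw [incl_tmul, Algebra.TensorProduct.tmul_mul_tmul, LinearMap.rTensor_tmul,
        LinearMap.rTensor_tmul, LinearMap.rTensor_tmul, coact_ι_mul, TensorProduct.add_tmul,
        map_add, ← Algebra.TensorProduct.tmul_mul_tmul, map_mul]
      congr 1
      generalize P.coact v = s
      induction s with
      | zero => simp
      | add s t hs ht => simp only [map_add, TensorProduct.add_tmul, hs, ht]
      | tmul a f =>
        rw [LinearMap.lTensor_tmul, Algebra.TensorProduct.assoc_tmul,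
          Algebra.TensorProduct.assoc_tmul, LinearMap.lTensor_tmul, actMul_tmul, act_ι]

/-- Coassociativity on L, carried along L → U(L). -/
lemma assoc_rTensor_base (X : L) :
    Algebra.TensorProduct.assoc ℂ ℂ ℂ U(L) F F (P.base.rTensor F (P.lieCoact X)) =
    (comul (R := ℂ) (A := F)).lTensor U(L) (P.base X) := by
  have h1 : ∀ t, Algebra.TensorProduct.assoc ℂ ℂ ℂ U(L) F F (P.base.rTensor F t) =
      (UniversalEnvelopingAlgebra.ι ℂ (L := L)).toLinearMap.rTensor (F ⊗[ℂ] F)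
        (TensorProduct.assoc ℂ L F F (P.lieCoact.rTensor F t)) := by
    intro t
    induction t with
    | zero => simp only [map_zero]
    | add s t hs ht => simp only [map_add, hs, ht]
    | tmul Y h =>
      rw [LinearMap.rTensor_tmul, LinearMap.rTensor_tmul, base_apply]
      generalize P.lieCoact Y = s
      induction s with
      | zero => simp
      | add s t hs ht => simp only [map_add, TensorProduct.add_tmul, hs, ht]
      | tmul Z f => rfl
  rw [h1, lieCoact_coassoc, base_apply]
  generalize P.lieCoact X = s
  induction s with
  | zero => simp only [map_zero]
  | add s t hs ht => simp only [map_add, hs, ht]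
  | tmul Z f => rfl

/-- Under u ↦ Xu both sides are multiplied by (id ⊗ Δ)▼X and gain the term in which `actMul (▼X)` +
id ⊗ X acts on F ⊗ F. On the left the `actMul` part comes from ▼(Yv), on the right from the formula
for Δ(X ▷ f). -/
lemma coact_coassoc (u : U(L)) :
    TensorProduct.assoc ℂ U(L) F F (P.coact.rTensor F (P.coact u)) =
      (comul (R := ℂ) (A := F)).lTensor U(L) (P.coact u) := by
  change Algebra.TensorProduct.assoc ℂ ℂ ℂ U(L) F F _ =
    Algebra.TensorProduct.map (.id ℂ _) (Bialgebra.comulAlgHom ℂ F) (P.coact u)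
  induction u using enveloping_induction_left with
  | one =>
    rw [coact_one, Algebra.TensorProduct.one_def, LinearMap.rTensor_tmul, coact_one,
      ← Algebra.TensorProduct.one_def, map_one]
    exact (map_one (Algebra.TensorProduct.map (.id ℂ U(L)) (Bialgebra.comulAlgHom ℂ F))).symm
  | add u v hu hv => simp only [map_add, hu, hv]
  | smul c u hu => simp only [map_smul, hu]
  | mul X u hu =>
    have h1 : ∀ w : U(L) ⊗[ℂ] F, Algebra.TensorProduct.assoc ℂ ℂ ℂ U(L) F F
        (P.coact.rTensor F ((P.der X).lTensor U(L) w)) =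
        ((P.der X).lTensor F).lTensor U(L)
          (Algebra.TensorProduct.assoc ℂ ℂ ℂ U(L) F F (P.coact.rTensor F w)) := by
      intro w
      induction w with
      | zero => simp only [map_zero]
      | add s t hs ht => simp only [map_add, hs, ht]
      | tmul v g =>
        rw [LinearMap.lTensor_tmul, LinearMap.rTensor_tmul, LinearMap.rTensor_tmul]
        generalize P.coact v = s
        induction s with
        | zero => simp
        | add s t hs ht => simp only [map_add, TensorProduct.add_tmul, hs, ht]
        | tmul Z f => rfl
    have h2 : ∀ w : U(L) ⊗[ℂ] F, Algebra.TensorProduct.map (.id ℂ U(L)) (Bialgebra.comulAlgHom ℂ F)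
        ((P.der X).lTensor U(L) w) =
        (P.actMul (P.base X) + (P.der X).lTensor F).lTensor U(L)
          (Algebra.TensorProduct.map (.id ℂ U(L)) (Bialgebra.comulAlgHom ℂ F) w) := by
      intro w
      induction w with
      | zero => simp only [map_zero]
      | add s t hs ht => simp only [map_add, hs, ht]
      | tmul v g =>
        rw [LinearMap.lTensor_tmul, Algebra.TensorProduct.map_tmul, Algebra.TensorProduct.map_tmul,
          LinearMap.lTensor_tmul]
        refine congrArg _ ((P.comul_der X g).trans ?_)
        rw [base_apply, actMul_incl]
        rfl
    rw [coact_ι_mul, map_add, map_add, map_add, h1, h2, base_apply,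
      assoc_rTensor_coact_incl_mul, assoc_rTensor_base, hu, LinearMap.lTensor_add,
      LinearMap.add_apply, add_assoc,
      map_mul (Algebra.TensorProduct.map (.id ℂ U(L)) (Bialgebra.comulAlgHom ℂ F))]
    rfl

variable (L F) in
/-- `u ⊗ f ↦ (u ⊗ 1) ⊗ f`. -/
def toLeft : U(L) ⊗[ℂ] F →ₐ[ℂ] (U(L) ⊗[ℂ] U(L)) ⊗[ℂ] F :=
  Algebra.TensorProduct.map Algebra.TensorProduct.includeLeft (.id ℂ F)

variable (L F) in
/-- `u ⊗ f ↦ (1 ⊗ u) ⊗ f`. -/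
def toRight : U(L) ⊗[ℂ] F →ₐ[ℂ] (U(L) ⊗[ℂ] U(L)) ⊗[ℂ] F :=
  Algebra.TensorProduct.map Algebra.TensorProduct.includeRight (.id ℂ F)

variable (L F) in
/-- `u ⊗ f ↦ Δ u ⊗ f`. -/
def comulLeft : U(L) ⊗[ℂ] F →ₐ[ℂ] (U(L) ⊗[ℂ] U(L)) ⊗[ℂ] F :=
  Algebra.TensorProduct.map (Bialgebra.comulAlgHom ℂ _) (.id ℂ F)

lemma toLeft_tmul (u : U(L)) (f : F) : toLeft L F (u ⊗ₜ f) = (u ⊗ₜ 1) ⊗ₜ f := rfl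

lemma toRight_tmul (u : U(L)) (f : F) : toRight L F (u ⊗ₜ f) = (1 ⊗ₜ u) ⊗ₜ f := rfl

lemma comulLeft_tmul (u : U(L)) (f : F) :
    comulLeft L F (u ⊗ₜ f) = comul (R := ℂ) u ⊗ₜ f := rfl

/-- Writes u₀ ⊗ v₀ ⊗ u₁v₁ as a product in an algebra, so that the recursion can be computed there.
-/
lemma toLeft_mul_toRight (s t : U(L) ⊗[ℂ] F) :
    toLeft L F s * toRight L F t = LinearMap.lTensor _ (LinearMap.mul' ℂ F)
      (TensorProduct.tensorTensorTensorComm ℂ U(L) F U(L) F (s ⊗ₜ t)) := by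
  induction s with
  | zero => simp
  | add s s' hs hs' => simp only [map_add, add_mul, TensorProduct.add_tmul, hs, hs']
  | tmul u f =>
    induction t with
    | zero => simp
    | add t t' ht ht' => simp only [map_add, mul_add, TensorProduct.tmul_add, ht, ht']
    | tmul v g =>
      rw [toLeft_tmul, toRight_tmul, Algebra.TensorProduct.tmul_mul_tmul,
        Algebra.TensorProduct.tmul_mul_tmul, mul_one, one_mul]
      rfl

/-- The two images use different copies of U(L) and share only the commutative F. -/
lemma commute_toLeft_toRight (s t : U(L) ⊗[ℂ] F) :
    toLeft L F s * toRight L F t = toRight L F t * toLeft L F s := by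
  induction s with
  | zero => simp
  | add s s' hs hs' => simp only [map_add, add_mul, mul_add, hs, hs']
  | tmul u f =>
    induction t with
    | zero => simp
    | add t t' ht ht' => simp only [map_add, add_mul, mul_add, ht, ht']
    | tmul v g =>
      simp only [toLeft_tmul, toRight_tmul, Algebra.TensorProduct.tmul_mul_tmul, mul_one, one_mul,
        mul_comm f g]

lemma toLeft_lTensor (D : Module.End ℂ F) (w : U(L) ⊗[ℂ] F) :
    toLeft L F (D.lTensor _ w) = D.lTensor _ (toLeft L F w) := by
  induction w with
  | zero => simp only [map_zero]
  | add s t hs ht => simp only [map_add, hs, ht]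
  | tmul v g => rfl

lemma toRight_lTensor (D : Module.End ℂ F) (w : U(L) ⊗[ℂ] F) :
    toRight L F (D.lTensor _ w) = D.lTensor _ (toRight L F w) := by
  induction w with
  | zero => simp only [map_zero]
  | add s t hs ht => simp only [map_add, hs, ht]
  | tmul v g => rfl

lemma comulLeft_lTensor (D : Module.End ℂ F) (w : U(L) ⊗[ℂ] F) :
    comulLeft L F (D.lTensor _ w) = D.lTensor _ (comulLeft L F w) := by
  induction w with
  | zero => simp only [map_zero]
  | add s t hs ht => simp only [map_add, hs, ht]
  | tmul v g => rfl

lemma comulLeft_incl (t : L ⊗[ℂ] F) : comulLeft L F (incl L F t) =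
    toLeft L F (incl L F t) + toRight L F (incl L F t) := by
  induction t with
  | zero => simp only [map_zero, add_zero]
  | add s t hs ht => simp only [map_add, hs, ht]; abel
  | tmul X f =>
    rw [incl_tmul, comulLeft_tmul, comul_ι, toLeft_tmul, toRight_tmul, TensorProduct.add_tmul]

/-- `u ⊗ v ↦ u₀ ⊗ v₀ ⊗ u₁ v₁`. -/
def coactTensor : U(L) ⊗[ℂ] U(L) →ₗ[ℂ] (U(L) ⊗[ℂ] U(L)) ⊗[ℂ] F :=
  LinearMap.mul' ℂ _ ∘ₗ TensorProduct.map ((toLeft L F).toLinearMap ∘ₗ P.coact)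
    ((toRight L F).toLinearMap ∘ₗ P.coact)

lemma coactTensor_tmul (u v : U(L)) :
    P.coactTensor (u ⊗ₜ v) = toLeft L F (P.coact u) * toRight L F (P.coact v) := rfl

/-- The summands X ⊗ 1 and 1 ⊗ X of ΔX contribute `toLeft` and `toRight` of ▼X, whose sum is
`comulLeft` of ▼X as L is primitive. The derivation terms add up by the Leibniz rule; commutation
brings `toRight` of ▼X to the front. -/
lemma coactTensor_comul_ι_mul (X : L) (u : U(L)) :
    P.coactTensor (comul (R := ℂ) (UniversalEnvelopingAlgebra.ι ℂ X * u)) =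
      comulLeft L F (P.base X) * P.coactTensor (comul (R := ℂ) u) +
        (P.der X).lTensor _ (P.coactTensor (comul (R := ℂ) u)) := by
  rw [comul_ι_mul, base_apply, comulLeft_incl, ← base_apply]
  generalize comul (R := ℂ) u = t
  induction t with
  | zero => simp
  | add s t hs ht => simp only [mul_add, map_add, hs, ht]; abel
  | tmul v w =>
    rw [add_mul, Algebra.TensorProduct.tmul_mul_tmul, Algebra.TensorProduct.tmul_mul_tmul,
      one_mul, one_mul, map_add, coactTensor_tmul, coactTensor_tmul, coactTensor_tmul,
      coact_ι_mul, coact_ι_mul, lTensor_derivation (P.der_mul X), ← toLeft_lTensor,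
      ← toRight_lTensor, map_add, map_add, map_mul, map_mul, add_mul, mul_add, ← mul_assoc,
      ← mul_assoc, commute_toLeft_toRight (P.coact v) (P.base X), add_mul, add_mul]
    abel

lemma comul_coact (u : U(L)) : (comul (R := ℂ) (A := U(L))).rTensor F (P.coact u) =
    (LinearMap.mul' ℂ F).lTensor (U(L) ⊗[ℂ] U(L))
      (TensorProduct.tensorTensorTensorComm ℂ U(L) F U(L) F
        (TensorProduct.map P.coact P.coact (comul (R := ℂ) u))) := by
  have h : ∀ t, P.coactTensor t = (LinearMap.mul' ℂ F).lTensor (U(L) ⊗[ℂ] U(L))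
      (TensorProduct.tensorTensorTensorComm ℂ U(L) F U(L) F
        (TensorProduct.map P.coact P.coact t)) := by
    intro t
    induction t with
    | zero => simp only [map_zero]
    | add s t hs ht => simp only [map_add, hs, ht]
    | tmul v w => rw [coactTensor_tmul, toLeft_mul_toRight, TensorProduct.map_tmul]
  rw [← h]
  change comulLeft L F (P.coact u) = _
  induction u using enveloping_induction_left with
  | one =>
    rw [Bialgebra.comul_one, coact_one, map_one, Algebra.TensorProduct.one_def (A := U(L)),
      coactTensor_tmul, coact_one, map_one, map_one, mul_one]
  | add u v hu hv => simp only [map_add, hu, hv]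
  | smul c u hu => simp only [map_smul, hu]
  | mul X u hu =>
    -- Δ ⊗ id is an algebra map commuting with X on F, so the left side obeys the recursion of
    -- `coactTensor_comul_ι_mul`.
    rw [coactTensor_comul_ι_mul, coact_ι_mul, map_add, map_mul, comulLeft_lTensor, hu]

end Coaction

/-! ### Assembly of the Hopf algebra matched pair -/

theorem isHopfMatchedPair : IsHopfMatchedPair ℂ P.act.toLinearMap P.coact where
  one_act f := by rw [AlgHom.toLinearMap_apply, map_one, Module.End.one_apply]
  mul_act u v f := by
    rw [AlgHom.toLinearMap_apply, map_mul, Module.End.mul_apply]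
    rfl
  act_one := P.act_one
  act_mul u f g := by
    refine (P.act_mul' u (f ⊗ₜ g)).trans ?_
    refine (sum_repr_eq (LinearMap.mul' ℂ F ∘ₗ LinearMap.applyₗ (f ⊗ₜ g) ∘ₗ
      P.actTensor.toLinearMap) u).symm
  coact_coassoc := P.coact_coassoc
  coact_counit := P.coact_counit
  comul_coact := P.comul_coact
  counit_coact := P.counit_coact
  counit_act := P.counit_act
  comul_act u f := by
    refine (P.comul_act u f).trans ?_
    rw [← sum_repr_eq (P.smash P.actMul (P.actRight F)) u, LinearMap.sum_apply]
    conv_lhs => rw [← (ℛ ℂ f).eq]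
    simp only [map_sum]
    refine Finset.sum_congr rfl fun i _ => Finset.sum_congr rfl fun j _ => ?_
    exact P.actMul_apply_tmul _ _ _
  coact_one := P.coact_one
  coact_mul := P.coactionMulRule_coact
  act_coact_comm := P.act_coact_comm

end LieHopfPair

/-! ### Tensors of polynomial functions are determined by point values -/

section Evaluation

variable {X Y : Type*} [AffineAlgebraicSet X] [AffineAlgebraicSet Y]
  {V : Type*} [AddCommGroup V] [Module ℂ V]

/-- The value of an element of `V ⊗ 𝒫(X)` at a point of `X`. -/
def evalRight (x : X) : V ⊗[ℂ] PolyFun X →ₗ[ℂ] V :=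
  (TensorProduct.rid ℂ V).toLinearMap ∘ₗ (evalAt x).toLinearMap.lTensor V

@[simp] lemma evalRight_tmul (x : X) (v : V) (f : PolyFun X) :
    evalRight x (v ⊗ₜ f) = f x • v := rfl

lemma evalRight_ext {s t : V ⊗[ℂ] PolyFun X} (h : ∀ x, evalRight x s = evalRight x t) :
    s = t := by
  apply (TensorProduct.comm ℂ V (PolyFun X)).injective
  refine tensor_ext fun x => ?_
  apply (TensorProduct.lid ℂ V).injective
  have key : ∀ s : V ⊗[ℂ] PolyFun X, TensorProduct.lid ℂ V
      ((evalAt x).toLinearMap.rTensor V (TensorProduct.comm ℂ V (PolyFun X) s)) =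
        evalRight x s := by
    intro s
    induction s with
    | zero => simp only [map_zero]
    | tmul v f => rfl
    | add s t hs ht => simp only [map_add, hs, ht]
  rw [key, key, h]

lemma evalRight_mul {A : Type*} [Ring A] [Algebra ℂ A] (x : X) (s t : A ⊗[ℂ] PolyFun X) :
    evalRight x (s * t) = evalRight x s * evalRight x t :=
  map_mul ((Algebra.TensorProduct.rid ℂ ℂ A).toAlgHom.comp
    (Algebra.TensorProduct.map (.id ℂ A) (evalAt x))) s t

lemma evalRight_rTensor {W : Type*} [AddCommGroup W] [Module ℂ W] (x : X) (T : V →ₗ[ℂ] W)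
    (t : V ⊗[ℂ] PolyFun X) : evalRight x (T.rTensor (PolyFun X) t) = T (evalRight x t) := by
  induction t with
  | zero => simp only [map_zero]
  | add s t hs ht => simp only [map_add, hs, ht]
  | tmul v f => simp

/-- The value of an element of `V ⊗ 𝒫(X) ⊗ 𝒫(Y)` at a pair of points. -/
def evalPairRight (x : X) (y : Y) : V ⊗[ℂ] (PolyFun X ⊗[ℂ] PolyFun Y) →ₗ[ℂ] V :=
  (TensorProduct.rid ℂ V).toLinearMap ∘ₗ (evalPair x y).toLinearMap.lTensor V

lemma evalPairRight_tmul (x : X) (y : Y) (v : V) (t : PolyFun X ⊗[ℂ] PolyFun Y) :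
    evalPairRight x y (v ⊗ₜ t) = evalPair x y t • v := rfl

/-- The identification 𝒫(X) ⊗ 𝒫(Y) = 𝒫(X × Y) reduces this to `evalRight_ext` on X × Y. -/
lemma evalPairRight_ext {s t : V ⊗[ℂ] (PolyFun X ⊗[ℂ] PolyFun Y)}
    (h : ∀ x y, evalPairRight x y s = evalPairRight x y t) : s = t := by
  apply (TensorProduct.congr (.refl ℂ V) (tensorEquivProd X Y).toLinearEquiv).injective
  refine evalRight_ext fun ⟨x, y⟩ => ?_
  have key : ∀ s : V ⊗[ℂ] (PolyFun X ⊗[ℂ] PolyFun Y), evalRight (x, y)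
      (TensorProduct.congr (.refl ℂ V) (tensorEquivProd X Y).toLinearEquiv s) =
        evalPairRight x y s := by
    intro s
    induction s with
    | zero => simp only [map_zero]
    | tmul v t =>
      rw [evalPairRight_tmul, ← tensorToProd_apply]
      rfl
    | add s t hs ht => simp only [map_add, hs, ht]
  rw [key, key, h]

lemma evalRight_apply (x : X) (y : Y) (t : PolyFun X ⊗[ℂ] PolyFun Y) :
    evalRight y t x = evalPair x y t := by
  rw [← evalAt_apply]
  induction t with
  | zero => simp only [map_zero]
  | tmul f g => simp [mul_comm]
  | add s t hs ht => simp only [map_add, hs, ht]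

/-- The partial evaluation `f ⊗ v ↦ f(x) v`. -/
def evalLeft (x : X) : PolyFun X ⊗[ℂ] V →ₗ[ℂ] V :=
  (TensorProduct.lid ℂ V).toLinearMap ∘ₗ (evalAt x).toLinearMap.rTensor V

@[simp] lemma evalLeft_tmul (x : X) (v : V) (f : PolyFun X) :
    evalLeft x (f ⊗ₜ v) = f x • v := rfl

lemma evalLeft_apply (x : X) (y : Y) (t : PolyFun X ⊗[ℂ] PolyFun Y) :
    evalLeft x t y = evalPair x y t := by
  rw [← evalAt_apply]
  induction t with
  | zero => simp only [map_zero]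
  | tmul f g => simp
  | add s t hs ht => simp only [map_add, hs, ht]

end Evaluation

/-! ### Differentiating functions of several group variables -/

section PointDerivation

variable {G : Type*} [Group G] [AffineAlgebraicSet G] [AffineAlgebraicGroup G]

lemma evalPair_comul (x y : G) (f : PolyFun G) :
    evalPair x y (comul (R := ℂ) f) = f (x * y) :=
  DFunLike.congr_fun (evalPair_polyComul x y) f

/-- The Leibniz rule for the restriction to the diagonal of a function of two variables. -/
lemma LieAlg.toDual_diag (X : LieAlg G) (k : PolyFun (G × G)) :
    X.toDual (pullback (fun φ => (φ, φ)) (isMorphism_prodMk isMorphism_id isMorphism_id) k) =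
    X.toDual (pullback (fun φ => (φ, 1))
      (isMorphism_prodMk isMorphism_id (isMorphism_const 1)) k) +
    X.toDual (pullback (fun φ => (1, φ))
      (isMorphism_prodMk (isMorphism_const 1) isMorphism_id) k) := by
  -- Products f(φ)g(φ') span the functions on G × G, and for them the claim is the defining rule of
  -- a point derivation.
  obtain ⟨t, rfl⟩ := tensorToProd_bijective.2 k
  induction t with
  | zero => simp only [map_zero, add_zero]
  | add s t hs ht => simp only [map_add, hs, ht]; ring
  | tmul f g =>
    have h0 : pullback (fun φ => (φ, φ)) (isMorphism_prodMk isMorphism_id isMorphism_id)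
        (tensorToProd G G (f ⊗ₜ g)) = f * g := rfl
    have h1 : pullback (fun φ => (φ, 1)) (isMorphism_prodMk isMorphism_id (isMorphism_const 1))
        (tensorToProd G G (f ⊗ₜ g)) = g 1 • f := PolyFun.ext fun φ => mul_comm (f φ) (g 1)
    have h2 : pullback (fun φ => (1, φ)) (isMorphism_prodMk (isMorphism_const 1) isMorphism_id)
        (tensorToProd G G (f ⊗ₜ g)) = f 1 • g := PolyFun.ext fun φ => rfl
    rw [h0, h1, h2, X.toDual_mul, map_smul, map_smul, smul_eq_mul, smul_eq_mul]
    ring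

/-- X ⊗ Y on Δf means differentiating f(φφ') along Y in φ', then along X in φ. -/
lemma pairFun_comul (X Y : LieAlg G) (f : PolyFun G) :
    pairFun X.toDual Y.toDual (comul (R := ℂ) f) =
      X.toDual (partialApply _ AffineAlgebraicGroup.isMorphism_mul Y.toDual f) := by
  have h : ∀ t : PolyFun G ⊗[ℂ] PolyFun G, pairFun X.toDual Y.toDual t =
      X.toDual (TensorProduct.rid ℂ (PolyFun G) (Y.toDual.lTensor (PolyFun G) t)) := by
    intro t
    induction t with
    | zero => simp only [map_zero]
    | tmul a b => simp [pairFun, mul_comm]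
    | add s t hs ht => simp only [map_add, hs, ht]
  exact h _

end PointDerivation

/-! ### The matched pair axioms differentiated at the identity -/

namespace MatchedPair

variable {G₁ G₂ : Type*} [Group G₁] [AffineAlgebraicSet G₁] [Group G₂] [AffineAlgebraicSet G₂]
  (M : MatchedPair G₁ G₂)

lemma isMorphism_tri_right (ψ : G₂) : IsMorphism (M.tri ψ) := isMorphism_right M.isMorphism_tri ψ

lemma isMorphism_ltri_right (ψ : G₂) : IsMorphism (M.ltri ψ) :=
  isMorphism_right M.isMorphism_ltri ψ

variable [AffineAlgebraicGroup G₁]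

lemma derivAct_apply (X : LieAlg G₁) (f : PolyFun G₂) (ψ : G₂) :
    M.derivAct X f ψ = X.toDual (pullback (M.ltri ψ) (M.isMorphism_ltri_right ψ) f) :=
  partialApply_apply _ M.isMorphism_ltri X.toDual f ψ

/-- As ψ ◁ 1 = ψ, the values at the identity in the rule for X become values at ψ. -/
lemma derivAct_mul (X : LieAlg G₁) (f g : PolyFun G₂) :
    M.derivAct X (f * g) = M.derivAct X f * g + f * M.derivAct X g := by
  refine PolyFun.ext fun ψ => ?_
  change _ = M.derivAct X f ψ * g ψ + f ψ * M.derivAct X g ψ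
  rw [derivAct_apply, derivAct_apply, derivAct_apply, map_mul, X.toDual_mul, pullback_apply,
    pullback_apply, ltri_one, add_comm]

lemma tangentAct_one (X : LieAlg G₁) : M.tangentAct 1 X = X := by
  refine LieAlg.toDual_injective (LinearMap.ext fun f => ?_)
  rw [tangentAct_toDual]
  exact congrArg _ (PolyFun.ext fun φ => congrArg f (M.one_tri φ))

lemma tangentAct_mul (ψ₁ ψ₂ : G₂) (X : LieAlg G₁) :
    M.tangentAct (ψ₁ * ψ₂) X = M.tangentAct ψ₁ (M.tangentAct ψ₂ X) := by
  refine LieAlg.toDual_injective (LinearMap.ext fun f => ?_)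
  rw [tangentAct_toDual, tangentAct_toDual, tangentAct_toDual]
  exact congrArg _ (PolyFun.ext fun φ => congrArg f (M.mul_tri ψ₁ ψ₂ φ))

/-- This is ψ ▷ (φφ') = (ψ ▷ φ)((ψ ◁ φ) ▷ φ') differentiated along Y in φ' and X in φ. The variable
φ occurs twice: varying it in ψ ▷ φ gives the first summand, varying it in ψ ◁ φ gives the second.
-/
lemma pairFun_comul_pullback_tri (ψ : G₂) (X Y : LieAlg G₁) (f : PolyFun G₁) :
    pairFun X.toDual Y.toDual
      (comul (R := ℂ) (pullback (M.tri ψ) (M.isMorphism_tri_right ψ) f)) =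
    pairFun (M.tangentAct ψ X).toDual (M.tangentAct ψ Y).toDual (comul (R := ℂ) f) +
      M.derivAct X (partialApply _ M.isMorphism_tri Y.toDual f) ψ := by
  -- The two occurrences of φ become the independent variables p.1.1 and p.1.2, and φ' is p.2.
  have hm : IsMorphism fun p : (G₁ × G₁) × G₁ =>
      M.tri ψ p.1.1 * M.tri (M.ltri ψ p.1.2) p.2 :=
    AffineAlgebraicGroup.isMorphism_mul.comp (isMorphism_prodMk
      ((M.isMorphism_tri_right ψ).comp (isMorphism_fst.comp isMorphism_fst))
      (M.isMorphism_tri.comp (isMorphism_prodMk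
        ((M.isMorphism_ltri_right ψ).comp (isMorphism_snd.comp isMorphism_fst)) isMorphism_snd)))
  rw [pairFun_comul, pairFun_comul, tangentAct_toDual, derivAct_apply]
  refine Eq.trans ?_ ((X.toDual_diag (partialApply _ hm Y.toDual f)).trans ?_)
  · refine congrArg _ (PolyFun.ext fun φ => ?_)
    rw [pullback_apply, partialApply_apply, partialApply_apply]
    refine congrArg _ (PolyFun.ext fun φ' => ?_)
    simp only [pullback_apply, tri_mul]
  · congr 1
    · refine congrArg _ (PolyFun.ext fun φ => ?_)
      rw [pullback_apply, pullback_apply, partialApply_apply, partialApply_apply,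
        tangentAct_toDual]
      refine congrArg _ (PolyFun.ext fun φ' => ?_)
      simp only [pullback_apply, ltri_one]
    · refine congrArg _ (PolyFun.ext fun φ => ?_)
      rw [pullback_apply, pullback_apply, partialApply_apply, partialApply_apply]
      refine congrArg _ (PolyFun.ext fun φ' => ?_)
      simp only [pullback_apply, tri_one, one_mul]

variable {ι : Type*} [Fintype ι] (b : Module.Basis ι ℂ (LieAlg G₁))

/-- A description of the coaction free of the basis; later arguments use only this. -/
lemma evalRight_polCoaction (ψ : G₂) (X : LieAlg G₁) :
    evalRight ψ (M.polCoaction b X) = M.tangentAct ψ X := by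
  have h : evalRight ψ ∘ₗ M.polCoaction b = M.tangentAct ψ := by
    refine b.ext fun i => ?_
    rw [LinearMap.comp_apply, polCoaction, b.constr_basis, map_sum]
    exact b.sum_repr _
  exact LinearMap.congr_fun h X

lemma toDual_evalRight_lTensor_derivAct (ψ : G₂) (X Y : LieAlg G₁) (f : PolyFun G₁) :
    (evalRight ψ ((M.derivAct X).lTensor (LieAlg G₁) (M.polCoaction b Y))).toDual f =
      M.derivAct X (partialApply _ M.isMorphism_tri Y.toDual f) ψ := by
  -- Pairing the first factor with f commutes with X on the second, and turns the coaction of Y into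
  -- the function ψ ↦ (ψ ▷ Y)(f).
  let c : LieAlg G₁ ⊗[ℂ] PolyFun G₂ →ₗ[ℂ] PolyFun G₂ :=
    (TensorProduct.lid ℂ _).toLinearMap ∘ₗ
      (LieAlg.toDual (G := G₁).flip f).rTensor (PolyFun G₂)
  have h1 : ∀ t, (evalRight ψ ((M.derivAct X).lTensor (LieAlg G₁) t)).toDual f =
      M.derivAct X (c t) ψ := by
    intro t
    rw [← evalAt_apply]
    induction t with
    | zero => simp only [map_zero, LinearMap.zero_apply]
    | add s t hs ht => simp only [map_add, LinearMap.add_apply, hs, ht]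
    | tmul Z g => simp [c, mul_comm]
  have h2 : ∀ t ψ, c t ψ = (evalRight ψ t).toDual f := by
    intro t ψ
    rw [← evalAt_apply]
    induction t with
    | zero => simp only [map_zero, LinearMap.zero_apply]
    | add s t hs ht => simp only [map_add, LinearMap.add_apply, hs, ht]
    | tmul Z g => simp [c, mul_comm]
  rw [h1]
  refine congrArg (fun g => M.derivAct X g ψ) (PolyFun.ext fun ψ' => ?_)
  rw [h2, evalRight_polCoaction, partialApply_apply, tangentAct_toDual]

/-- The antisymmetrization of `pairFun_comul_pullback_tri` in X and Y. -/
lemma tangentAct_lie (ψ : G₂) (X Y : LieAlg G₁) :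
    M.tangentAct ψ ⁅X, Y⁆ = ⁅M.tangentAct ψ X, M.tangentAct ψ Y⁆ +
      (evalRight ψ ((M.derivAct X).lTensor (LieAlg G₁) (M.polCoaction b Y)) -
        evalRight ψ ((M.derivAct Y).lTensor (LieAlg G₁) (M.polCoaction b X))) := by
  refine LieAlg.toDual_injective (LinearMap.ext fun f => ?_)
  rw [map_add, map_sub, LinearMap.add_apply, LinearMap.sub_apply,
    toDual_evalRight_lTensor_derivAct, toDual_evalRight_lTensor_derivAct, tangentAct_toDual,
    LieAlg.toDual_lie, LieAlg.toDual_lie]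
  have h1 := M.pairFun_comul_pullback_tri ψ X Y f
  have h2 := M.pairFun_comul_pullback_tri ψ Y X f
  refine (congrArg₂ (· - ·) h1 h2).trans ?_
  ring

variable [AffineAlgebraicGroup G₂]

/-- Since 1 ◁ φ = 1, the function φ ↦ f(1 ◁ φ) is constant and X kills it. -/
lemma counit_derivAct (X : LieAlg G₁) (f : PolyFun G₂) :
    counit (R := ℂ) (M.derivAct X f) = 0 := by
  rw [counit_eq, derivAct_apply, ← X.toDual_algebraMap (f 1)]
  exact congrArg _ (PolyFun.ext fun φ => congrArg f (M.one_ltri φ))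

/-- The derivative of (ψ₁ψ₂) ◁ φ = (ψ₁ ◁ (ψ₂ ▷ φ))(ψ₂ ◁ φ) in φ, one summand for each factor. In the
first factor φ enters through ψ₂ ▷ φ, whence ψ₂ ▷ X. -/
lemma derivAct_apply_mul (X : LieAlg G₁) (f : PolyFun G₂) (ψ₁ ψ₂ : G₂) :
    M.derivAct X f (ψ₁ * ψ₂) =
      M.derivAct (M.tangentAct ψ₂ X) (evalRight ψ₂ (comul (R := ℂ) f)) ψ₁ +
      M.derivAct X (evalLeft ψ₁ (comul (R := ℂ) f)) ψ₂ := by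
  have hm : IsMorphism fun p : G₁ × G₁ => M.ltri ψ₁ (M.tri ψ₂ p.1) * M.ltri ψ₂ p.2 :=
    AffineAlgebraicGroup.isMorphism_mul.comp (isMorphism_prodMk
      ((M.isMorphism_ltri_right ψ₁).comp ((M.isMorphism_tri_right ψ₂).comp isMorphism_fst))
      ((M.isMorphism_ltri_right ψ₂).comp isMorphism_snd))
  rw [derivAct_apply, derivAct_apply, derivAct_apply, tangentAct_toDual]
  refine Eq.trans ?_ ((X.toDual_diag (pullback _ hm f)).trans ?_)
  · refine congrArg _ (PolyFun.ext fun φ => ?_)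
    simp only [pullback_apply, mul_ltri]
  · congr 1 <;> refine congrArg _ (PolyFun.ext fun φ => ?_)
    · simp only [pullback_apply, evalRight_apply, evalPair_comul, ltri_one]
    · simp only [pullback_apply, evalLeft_apply, evalPair_comul, tri_one, ltri_one]

lemma comul_derivAct (X : LieAlg G₁) (f : PolyFun G₂) :
    comul (R := ℂ) (M.derivAct X f) =
    TensorProduct.homTensorHomMap (.id ℂ) _ _ _ _
      (TensorProduct.map M.derivAct.toLinearMap (LinearMap.mul ℂ (PolyFun G₂))
        (M.polCoaction b X)) (comul f) +
    (M.derivAct X).lTensor (PolyFun G₂) (comul f) := by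
  refine evalPair_ext fun ψ₁ ψ₂ => ?_
  have h1 : ∀ (t : LieAlg G₁ ⊗[ℂ] PolyFun G₂) (s : PolyFun G₂ ⊗[ℂ] PolyFun G₂),
      evalPair ψ₁ ψ₂ (TensorProduct.homTensorHomMap (.id ℂ) _ _ _ _
        (TensorProduct.map M.derivAct.toLinearMap (LinearMap.mul ℂ (PolyFun G₂)) t) s) =
      M.derivAct (evalRight ψ₂ t) (evalRight ψ₂ s) ψ₁ := by
    intro t s
    rw [← evalAt_apply]
    induction t with
    | zero => simp only [map_zero, LinearMap.zero_apply]
    | add t t' ht ht' => simp only [map_add, LinearMap.add_apply, ht, ht']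
    | tmul Z h =>
      induction s with
      | zero => simp only [map_zero]
      | add s s' hs hs' => simp only [map_add, hs, hs']
      | tmul g g' =>
        rw [TensorProduct.map_tmul, TensorProduct.homTensorHomMap_apply, TensorProduct.map_tmul,
          evalPair_tmul, evalRight_tmul, evalRight_tmul, map_smul, map_smul,
          map_smul M.derivAct, LinearMap.smul_apply, map_smul, evalAt_apply, smul_eq_mul,
          smul_eq_mul]
        change M.derivAct Z g ψ₁ * (h ψ₂ * g' ψ₂) = _
        ring
  have h2 : ∀ s : PolyFun G₂ ⊗[ℂ] PolyFun G₂,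
      evalPair ψ₁ ψ₂ ((M.derivAct X).lTensor (PolyFun G₂) s) =
      M.derivAct X (evalLeft ψ₁ s) ψ₂ := by
    intro s
    rw [← evalAt_apply]
    induction s with
    | zero => simp only [map_zero]
    | add s s' hs hs' => simp only [map_add, hs, hs']
    | tmul g g' => simp
  rw [evalPair_comul, map_add, h1, h2, evalRight_polCoaction, derivAct_apply_mul]

/-- At (ψ₁, ψ₂) this is the action law (ψ₁ψ₂) ▷ X = ψ₁ ▷ (ψ₂ ▷ X). -/
lemma polCoaction_coassoc (X : LieAlg G₁) :
    TensorProduct.assoc ℂ _ _ _ ((M.polCoaction b).rTensor (PolyFun G₂) (M.polCoaction b X)) =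
      (comul (R := ℂ) (A := PolyFun G₂)).lTensor (LieAlg G₁) (M.polCoaction b X) := by
  refine evalPairRight_ext fun ψ₁ ψ₂ => ?_
  have h1 : ∀ t : LieAlg G₁ ⊗[ℂ] PolyFun G₂, evalPairRight ψ₁ ψ₂
      (TensorProduct.assoc ℂ _ _ _ ((M.polCoaction b).rTensor (PolyFun G₂) t)) =
      M.tangentAct ψ₁ (evalRight ψ₂ t) := by
    intro t
    induction t with
    | zero => simp only [map_zero]
    | add s t hs ht => simp only [map_add, hs, ht]
    | tmul Y h =>
      rw [LinearMap.rTensor_tmul, evalRight_tmul, map_smul, ← M.evalRight_polCoaction b]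
      generalize M.polCoaction b Y = s
      induction s with
      | zero => simp
      | add s t hs ht => simp only [map_add, TensorProduct.add_tmul, smul_add, hs, ht]
      | tmul Z g =>
        rw [TensorProduct.assoc_tmul, evalPairRight_tmul, evalPair_tmul, evalRight_tmul, smul_smul,
          mul_comm]
  have h2 : ∀ t : LieAlg G₁ ⊗[ℂ] PolyFun G₂, evalPairRight ψ₁ ψ₂
      ((comul (R := ℂ) (A := PolyFun G₂)).lTensor (LieAlg G₁) t) =
      evalRight (ψ₁ * ψ₂) t := by
    intro t
    induction t with
    | zero => simp only [map_zero]
    | add s t hs ht => simp only [map_add, hs, ht]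
    | tmul Y h =>
      rw [LinearMap.lTensor_tmul, evalPairRight_tmul, evalPair_comul, evalRight_tmul]
  rw [h1, h2, evalRight_polCoaction, evalRight_polCoaction, tangentAct_mul]

/-- The Lie algebra `𝔤₁` with its action and coaction on `𝒫(G₂)`. -/
def lieHopfPair : LieHopfPair (LieAlg G₁) (PolyFun G₂) where
  der := M.derivAct
  lieCoact := M.polCoaction b
  der_mul := M.derivAct_mul
  counit_der := M.counit_derivAct
  lieCoact_coassoc := M.polCoaction_coassoc b
  -- The counit of 𝒫(G₂) is evaluation at 1, so id ⊗ ε is `evalRight 1`.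
  lieCoact_counit X := (M.evalRight_polCoaction b 1 X).trans (M.tangentAct_one X)
  comul_der := M.comul_derivAct b
  lieCoact_lie X Y := by
    refine evalRight_ext fun ψ => ?_
    rw [LieRing.of_associative_ring_bracket, map_add, map_sub, map_sub, evalRight_mul,
      evalRight_mul]
    simp only [evalRight_rTensor, evalRight_polCoaction]
    rw [M.tangentAct_lie b]
    simp only [map_add, map_sub]
    refine congrArg₂ _ ?_ rfl
    exact LieHom.map_lie (UniversalEnvelopingAlgebra.ι ℂ) _ _

end MatchedPair

end AlgGroup

end

theorem mainTheorem8 {G₁ G₂ : Type*} [Group G₁] [AlgGroup.AffineAlgebraicSet G₁]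
    [AlgGroup.AffineAlgebraicGroup G₁] [Group G₂] [AlgGroup.AffineAlgebraicSet G₂]
    [AlgGroup.AffineAlgebraicGroup G₂] (M : AlgGroup.MatchedPair G₁ G₂)
    {ι : Type*} [Fintype ι] (b : Module.Basis ι ℂ (AlgGroup.LieAlg G₁)) :
    ∃ coact : UniversalEnvelopingAlgebra ℂ (AlgGroup.LieAlg G₁) →ₗ[ℂ]
        UniversalEnvelopingAlgebra ℂ (AlgGroup.LieAlg G₁) ⊗[ℂ] AlgGroup.PolyFun G₂,
      M.IsEnvCoaction b coact ∧
      (∀ coact', M.IsEnvCoaction b coact' → coact' = coact) ∧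
      AlgGroup.IsHopfMatchedPair ℂ M.envAct.toLinearMap coact := by
  -- `M.envAct` and `(M.lieHopfPair b).act` are by definition the same lift of `M.derivAct`, so the
  -- abstract results apply as they stand.
  refine ⟨(M.lieHopfPair b).coact, ⟨fun X => (M.lieHopfPair b).coact_ι X,
    (M.lieHopfPair b).coact_one, (M.lieHopfPair b).coactionMulRule_coact⟩, fun coact' h => ?_,
    (M.lieHopfPair b).isHopfMatchedPair⟩
  exact (M.lieHopfPair b).eq_coact h.coact_one h.coact_ι h.coact_mul
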